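/- A lattice polytope in $\mathbb{R}^d$ is the convex hull of finitely many points of $\mathbb{Z}^d$. A unimodular simplex is a simplex that is lattice equivalent to a standard simplex $\operatorname{conv}\{0,e_1,\dots,e_k\}\subset\mathbb{R}^k$, where the lattice is the set of integer points in its affine span (so it need not be full-dimensional). A unimodular triangulation of a lattice polytope $P$ is a finite simplicial complex with union $P$ all of whose maximal simplices are unimodular. Let $Q\subset\mathbb{R}^d$ and $P_i\subset\mathbb{R}^{d_i}$ ($i=1,\dots,n$) be lattice polytopes, and let $\phi=(\phi_1,\dots,\phi_n):\mathbb{R}^d\to\mathbb{R}^n$ be an affine map with $\phi(\mathbb{Z}^d)\subset\mathbb{Z}^n$ and $\phi_i\ge 0$ on $Q$ for all $i$. The semidirect product is $$Q\ltimes_\phi(P_1,\dots,P_n):=\operatorname{conv}\Bigl(\bigcup_{a\in Q}\{a\}\times\prod_{i=1}^n\phi_i(a)P_i\Bigr)\subset\mathbb{R}^d\times\prod_{i=1}^n\mathbb{R}^{d_i},$$ with lattice $\mathbb{Z}^d\times\prod_i\mathbb{Z}^{d_i}$. (1) Let $n=1$ and $P=P_1$. If $\mathcal{S}$ and $\mathcal{T}$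 are unimodular triangulations of $Q$ and $P$, then $Q\ltimes_\phi P$ has a unimodular triangulation that refines the pull-back $\pi^*\mathcal{S}$ of $\mathcal{S}$ by the projection $\pi:Q\ltimes_\phi P\to Q$. Here the cells of $\pi^*\mathcal{S}$ are the sets $(Q\ltimes_\phi P)\cap\pi^{-1}(F)$ for the maximal simplices $F$ of $\mathcal{S}$, and refining means that every simplex of the new triangulation lies in one of these cells. (2) If $Q,P_1,\dots,P_n$ admit unimodular triangulations, then $Q\ltimes_\phi(P_1,\dots,P_n)$ admits a unimodular triangulation. (3) In particular, let $Q\subset k\Delta^d$ be a lattice polytope, where $k\in\mathbb{N}$ and $\Delta^d=\{x\in\mathbb{R}^{d+1}:x\ge 0,\ \sum_i x_i=1\}$, and let $P_1,\dots,P_{d+1}$ be lattice polytopes. If $Q,P_1,\dots,P_{d+1}$ admit unimodular triangulations, then so does the nested polytope $$\operatorname{NP}(Q;P_1,\dots,P_{d+1}):=\operatorname{conv}\Bigl(\bigcup_{a\text{ a vertex of }Q}\{a\}\times\prod_{i=1}^{d+1}a_iP_i\Bigr).$$ No triangulation here is assumed to be regular. -/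

import Mathlib

open scoped Pointwise

/-- The lattice `ℤ^ι` inside `ℝ^ι`. -/
def integerLattice (ι : Type*) : AddSubgroup (ι → ℝ) :=
  AddSubgroup.pi Set.univ fun _ => (Int.castAddHom ℝ).range

/-- The lattice `ℤ^d × ∏ i, ℤ^(e i)` inside `ℝ^d × ∏ i, ℝ^(e i)`. -/
def productLattice (d : ℕ) {n : ℕ} (e : Fin n → ℕ) :
    AddSubgroup ((Fin d → ℝ) × (∀ i : Fin n, Fin (e i) → ℝ)) :=
  (integerLattice (Fin d)).prod
    (AddSubgroup.pi Set.univ fun i => integerLattice (Fin (e i)))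

/-- A lattice polytope: the convex hull of finitely many lattice points. -/
def IsLatticePolytope {E : Type*} [AddCommGroup E] [Module ℝ E]
    (L : AddSubgroup E) (P : Set E) : Prop :=
  ∃ V : Finset E, (V : Set E) ⊆ L ∧ P = convexHull ℝ (V : Set E)

/-- The finite set `s` is the vertex set of a unimodular simplex: some injective affine map from
`ℝ^k` sends the vertices `0, e₁, …, e_k` of the standard simplex onto `s` and identifies `ℤ^k` with
the lattice points in its image, the affine span of `s`. -/
def IsUnimodularSimplex {E : Type*} [AddCommGroup E] [Module ℝ E]
    (L : AddSubgroup E) (s : Finset E) : Prop :=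
  ∃ (k : ℕ) (f : (Fin k → ℝ) →ᵃ[ℝ] E), Function.Injective f ∧
    (∀ x, f x ∈ L ↔ x ∈ integerLattice (Fin k)) ∧
    f '' insert 0 (Set.range fun i : Fin k => (Pi.single i 1 : Fin k → ℝ)) = (s : Set E)

/-- `K` is a unimodular triangulation of `P`: a finite simplicial complex with union `P` all of
whose maximal simplices are unimodular. -/
structure IsUnimodularTriangulation {E : Type*} [AddCommGroup E] [Module ℝ E]
    (L : AddSubgroup E) (P : Set E) (K : Geometry.SimplicialComplex ℝ E) : Prop where
  finite : K.faces.Finite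
  space_eq : K.space = P
  unimodular : ∀ s ∈ K.facets, IsUnimodularSimplex L s

/-- The cells of the pull-back to `R`, along `π`, of the complex `S`: the intersections of `R` with
the prisms `π⁻¹(F)` over the maximal simplices `F` of `S`. -/
def pullbackCells {E F : Type*} [AddCommGroup E] [Module ℝ E] [AddCommGroup F] [Module ℝ F]
    (π : E →ₗ[ℝ] F) (R : Set E) (S : Geometry.SimplicialComplex ℝ F) : Set (Set E) :=
  {C | ∃ s ∈ S.facets, C = R ∩ π ⁻¹' convexHull ℝ (s : Set F)}

/-- The complex `K` refines a subdivision with the given cells: every simplex of `K` lies in one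
of the cells. -/
def Refines {E : Type*} [AddCommGroup E] [Module ℝ E]
    (K : Geometry.SimplicialComplex ℝ E) (cells : Set (Set E)) : Prop :=
  ∀ s ∈ K.faces, ∃ C ∈ cells, convexHull ℝ (s : Set E) ⊆ C

/-- The semidirect product `Q ⋉_φ (P₁, …, P_n)`, the convex hull of the sets
`{a} × ∏ i, φ_i(a) P_i` for `a ∈ Q`. -/
def semidirectProduct {d n : ℕ} {e : Fin n → ℕ} (Q : Set (Fin d → ℝ))
    (φ : (Fin d → ℝ) →ᵃ[ℝ] (Fin n → ℝ)) (P : ∀ i : Fin n, Set (Fin (e i) → ℝ)) :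
    Set ((Fin d → ℝ) × (∀ i : Fin n, Fin (e i) → ℝ)) :=
  convexHull ℝ (⋃ a ∈ Q, {a} ×ˢ Set.pi Set.univ fun i => φ a i • P i)

/-- The nested polytope `NP(Q; P₁, …, P_n)`, the convex hull of the sets `{a} × ∏ i, a_i P_i`
for `a` a vertex of `Q`. -/
def nestedPolytope {n : ℕ} {e : Fin n → ℕ} (Q : Set (Fin n → ℝ))
    (P : ∀ i : Fin n, Set (Fin (e i) → ℝ)) :
    Set ((Fin n → ℝ) × (∀ i : Fin n, Fin (e i) → ℝ)) :=
  convexHull ℝ (⋃ a ∈ Set.extremePoints ℝ Q, {a} ×ˢ Set.pi Set.univ fun i => a i • P i)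

/-- `φ` is an integer affine map that is nonnegative on `Q`. -/
structure IsAdmissibleMap {d n : ℕ} (Q : Set (Fin d → ℝ))
    (φ : (Fin d → ℝ) →ᵃ[ℝ] (Fin n → ℝ)) : Prop where
  integral : ∀ x ∈ integerLattice (Fin d), φ x ∈ integerLattice (Fin n)
  nonneg : ∀ a ∈ Q, ∀ i, 0 ≤ φ a i

/-!
Homogenize: a unimodular triangulation of a lattice polytope `P` is a unimodular fan, with rays at
height one, on the cone over `P`. The cone over the semidirect product is the fibre product of the
cones over `Q` and over the `P i`, along the linear form that homogenizes `φ i` on the former and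
the height on the latter, so it suffices to construct unimodular fans on such fibre products, and
these need not be regular since the construction is local over the cones of `Q`.

Give the points of the cone over `P i` one coordinate for each vertex of its triangulation. Over a
cone of a unimodular fan on which a linear form `ψ` is nonnegative and integral, the region
`0 ≤ h ≤ ψ x` is a union of unimodular cones arranged like a staircase, and these fit together
because they are determined by an order of the rays. Each new coordinate is bounded by the room
left by those before it in the block of `i`, that is, by `φ i` minus their sum. In the resulting
fan, the conditions that the coordinates of every block sum to `φ i` and are supported on a face of
the triangulation of `P i` cut out a union of cones. Replacing the coordinates by the points with
these weights, dropping the heights and slicing at height one gives the triangulation.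
-/

universe u v

section Integers

variable {ι M : Type*} [AddCommGroup M] [Module ℝ M]

/-- The lattice `ℤ` inside `ℝ`. -/
def intLattice : AddSubgroup ℝ := (Int.castAddHom ℝ).range

theorem natCast_mem_intLattice (n : ℕ) : (n : ℝ) ∈ intLattice := ⟨n, by simp⟩

theorem mem_integerLattice {x : ι → ℝ} : x ∈ integerLattice ι ↔ ∀ i, x i ∈ intLattice := by
  simp [integerLattice, intLattice, AddSubgroup.mem_pi]

theorem smul_mem_of_mem_intLattice {L : AddSubgroup M} {r : ℝ} {x : M} (hr : r ∈ intLattice)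
    (hx : x ∈ L) : r • x ∈ L := by
  obtain ⟨n, rfl⟩ := hr
  simpa only [Int.coe_castAddHom, Int.cast_smul_eq_zsmul] using L.zsmul_mem hx n

theorem linearCombination_mem [Fintype ι] {L : AddSubgroup M} {v : ι → M} {w : ι → ℝ}
    (hw : w ∈ integerLattice ι) (hv : ∀ i, v i ∈ L) : Fintype.linearCombination ℝ v w ∈ L :=
  sum_mem fun i _ => smul_mem_of_mem_intLattice (mem_integerLattice.1 hw i) (hv i)

theorem single_one_mem_integerLattice [DecidableEq ι] (i : ι) :
    (Pi.single i 1 : ι → ℝ) ∈ integerLattice ι :=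
  mem_integerLattice.2 fun j => by
    by_cases h : j = i
    · simpa [h] using natCast_mem_intLattice 1
    · simp [h]

end Integers

section Greedy

variable {ι : Type*} [LinearOrder ι]

/-- The vector `x` fills the capacities `b` in increasing order of the index: it uses an index only
after all earlier ones are full. -/
structure IsGreedy (b x : ι → ℝ) : Prop where
  nonneg : 0 ≤ x
  le : x ≤ b
  full_or_empty : ∀ ⦃i j⦄, i < j → x i = b i ∨ x j = 0

theorem sum_sub_prefix_sums_eq (g : ℝ → ℝ) (b : ι → ℝ) (s : Finset ι) :
    ∑ i ∈ s, (g (∑ j ∈ s with j < i, b j + b i) - g (∑ j ∈ s with j < i, b j)) =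
      g (∑ i ∈ s, b i) - g 0 := by
  induction s using Finset.induction_on_max with
  | empty => simp
  | insert a s ha ih =>
    have prefix_self : {j ∈ insert a s | j < a} = s := by
      ext j
      simp only [Finset.mem_filter, Finset.mem_insert]
      exact ⟨fun h => h.1.resolve_left h.2.ne, fun h => ⟨.inr h, ha j h⟩⟩
    have prefix_of_mem : ∀ i ∈ s, {j ∈ insert a s | j < i} = {j ∈ s | j < i} := fun i hi => by
      rw [Finset.filter_insert, if_neg (ha i hi).le.not_gt]
    have not_mem : a ∉ s := fun h => lt_irrefl _ (ha a h)
    have sum_eq : ∑ i ∈ s, (g (∑ j ∈ insert a s with j < i, b j + b i) -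
        g (∑ j ∈ insert a s with j < i, b j)) = g (∑ i ∈ s, b i) - g 0 :=
      (Finset.sum_congr rfl fun i hi => by rw [prefix_of_mem i hi]).trans ih
    rw [Finset.sum_insert not_mem, Finset.sum_insert not_mem, prefix_self, sum_eq, add_comm (b a)]
    ring

variable [Fintype ι] {b x y : ι → ℝ}

theorem IsGreedy.eq_of_sum_eq (hx : IsGreedy b x) (hy : IsGreedy b y)
    (h : ∑ i, x i = ∑ i, y i) : x = y := by
  by_contra hne
  obtain ⟨i, hi⟩ : ∃ i, x i < y i := by
    by_contra! hle
    exact hne (funext fun i =>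
      ((Finset.sum_eq_sum_iff_of_le fun i _ => hle i).1 h.symm i (Finset.mem_univ i)).symm)
  obtain ⟨j, hj⟩ : ∃ j, y j < x j := by
    by_contra! hle
    exact hne (funext fun i =>
      (Finset.sum_eq_sum_iff_of_le fun i _ => hle i).1 h i (Finset.mem_univ i))
  have hx_lt : ¬ i < j := fun hij =>
    (hx.full_or_empty hij).elim (fun h => by linarith [hy.le i])
      fun h => by linarith [show 0 ≤ y j from hy.nonneg j]
  have hy_lt : ¬ j < i := fun hji =>
    (hy.full_or_empty hji).elim (fun h => by linarith [hx.le j])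
      fun h => by linarith [show 0 ≤ x i from hx.nonneg i]
  obtain rfl := le_antisymm (not_lt.1 hy_lt) (not_lt.1 hx_lt)
  exact lt_asymm hi hj

/-- At most one coordinate is neither empty nor full, and it is determined by the total. -/
theorem IsGreedy.mem_integerLattice (hx : IsGreedy b x) (hb : b ∈ integerLattice ι)
    (h : ∑ i, x i ∈ intLattice) : x ∈ integerLattice ι := by
  rw [_root_.mem_integerLattice] at hb ⊢
  intro i
  by_contra hi
  have others : ∀ j, j ≠ i → x j ∈ intLattice := fun j hj => by
    rcases lt_or_gt_of_ne hj with hji | hij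
    · exact (hx.full_or_empty hji).elim (fun h => h ▸ hb j)
        fun h => absurd (h ▸ intLattice.zero_mem) hi
    · exact (hx.full_or_empty hij).elim (fun h => absurd (h ▸ hb i) hi)
        fun h => h ▸ intLattice.zero_mem
  rw [← Finset.add_sum_erase _ _ (Finset.mem_univ i),
    intLattice.add_mem_cancel_right (sum_mem fun j hj => others j (Finset.ne_of_mem_erase hj))] at h
  exact hi h

theorem exists_isGreedy (hb : 0 ≤ b) {h : ℝ} (h0 : 0 ≤ h) (hle : h ≤ ∑ i, b i) :
    ∃ x, IsGreedy b x ∧ ∑ i, x i = h := by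
  let B : ι → ℝ := fun i => ∑ j with j < i, b j
  have B_add_le : ∀ ⦃i j⦄, i < j → B i + b i ≤ B j := fun i j hij => by
    rw [add_comm, ← Finset.sum_insert (by simp)]
    refine Finset.sum_le_sum_of_subset_of_nonneg (fun k hk => ?_) fun k _ _ => hb k
    rcases Finset.mem_insert.1 hk with rfl | hk
    · simpa using hij
    · simpa using (Finset.mem_filter.1 hk).2.trans hij
  refine ⟨fun i => min h (B i + b i) - min h (B i), ⟨fun i => ?_, fun i => ?_, fun i j hij => ?_⟩,
    ?_⟩
  · exact sub_nonneg.2 (min_le_min_left h (le_add_of_nonneg_right (hb i)))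
  · rw [sub_le_iff_le_add, ← min_add_add_left, add_comm (b i) (B i)]
    exact min_le_min_right _ (le_add_of_nonneg_left (hb i))
  · rcases le_total (B i + b i) h with hi | hi
    · exact .inl (by rw [min_eq_right hi,
        min_eq_right ((le_add_of_nonneg_right (hb i)).trans hi), add_sub_cancel_left])
    · have hj : h ≤ B j := hi.trans (B_add_le hij)
      exact .inr (by rw [min_eq_left hj,
        min_eq_left (hj.trans (le_add_of_nonneg_right (hb j))), sub_self])
  · rw [sum_sub_prefix_sums_eq (min h), min_eq_left hle, min_eq_right h0, sub_zero]

end Greedy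

section Column

variable {c m : ℕ} {f g : Fin (c + 1) → ℝ}

/-- The first moment `∑ k, k * f k` of a weight function on `{0, …, n - 1}`. -/
def moment (n : ℕ) : (Fin n → ℝ) →ₗ[ℝ] ℝ := Fintype.linearCombination ℝ fun k => (k : ℝ)

theorem moment_apply {n : ℕ} (f : Fin n → ℝ) : moment n f = ∑ k, f k * (k : ℕ) := by
  simp [moment, Fintype.linearCombination_apply]

theorem moment_nonneg {n : ℕ} {f : Fin n → ℝ} (hf : 0 ≤ f) : 0 ≤ moment n f := by
  rw [moment_apply]
  exact Finset.sum_nonneg fun k _ => mul_nonneg (hf k) (Nat.cast_nonneg _)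

theorem val_cast_le (k : Fin (c + 1)) : ((k : ℕ) : ℝ) ≤ c := by exact_mod_cast k.is_le

theorem moment_le (hf : 0 ≤ f) : moment (c + 1) f ≤ c * ∑ k, f k := by
  rw [moment_apply, mul_comm, Finset.sum_mul]
  exact Finset.sum_le_sum fun k _ => mul_le_mul_of_nonneg_left (val_cast_le k) (hf k)

theorem eq_top_of_moment_eq (hf : 0 ≤ f) (h : moment (c + 1) f = c * ∑ k, f k) {k : Fin (c + 1)}
    (hk : f k ≠ 0) : (k : ℕ) = c := by
  rw [moment_apply, mul_comm, Finset.sum_mul] at h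
  have := (Finset.sum_eq_sum_iff_of_le fun k _ =>
    mul_le_mul_of_nonneg_left (val_cast_le k) (hf k)).1 h k (Finset.mem_univ k)
  exact_mod_cast mul_left_cancel₀ hk this

theorem eq_zero_of_moment_eq_zero (hf : 0 ≤ f) (h : moment (c + 1) f = 0) {k : Fin (c + 1)}
    (hk : f k ≠ 0) : (k : ℕ) = 0 := by
  rw [moment_apply, Finset.sum_eq_zero_iff_of_nonneg
    fun k _ => mul_nonneg (hf k) (Nat.cast_nonneg _)] at h
  simpa [hk] using h k (Finset.mem_univ k)

/-- A set of at most two consecutive heights. -/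
def IsConsecutive {n : ℕ} (s : Set (Fin n)) : Prop :=
  ∃ m : ℕ, ∀ k ∈ s, (k : ℕ) = m ∨ (k : ℕ) = m + 1

theorem sum_ite_eq_lower (hf : ∀ k ∈ Function.support f, (k : ℕ) = m ∨ (k : ℕ) = m + 1) :
    ∑ k : Fin (c + 1), (if (k : ℕ) = m then f k else 0) =
      (m + 1) * ∑ k, f k - moment (c + 1) f := by
  rw [moment_apply, Finset.mul_sum, ← Finset.sum_sub_distrib]
  refine Finset.sum_congr rfl fun k _ => ?_
  by_cases h0 : f k = 0
  · simp [h0]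
  · rcases hf k h0 with hk | hk <;>
      simp only [hk, Nat.succ_ne_self, ↓reduceIte, Nat.cast_add, Nat.cast_one] <;>
      ring

theorem sum_ite_eq_upper (hf : ∀ k ∈ Function.support f, (k : ℕ) = m ∨ (k : ℕ) = m + 1) :
    ∑ k : Fin (c + 1), (if (k : ℕ) = m + 1 then f k else 0) =
      moment (c + 1) f - m * ∑ k, f k := by
  rw [moment_apply, Finset.mul_sum, ← Finset.sum_sub_distrib]
  refine Finset.sum_congr rfl fun k _ => ?_
  by_cases h0 : f k = 0
  · simp [h0]
  · rcases hf k h0 with hk | hk <;>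
      simp only [hk, Nat.left_eq_add, one_ne_zero, ↓reduceIte, Nat.cast_add, Nat.cast_one] <;>
      ring

/-- The tent function does not mention which two heights carry the weights, so these are determined
by their sum and moment. -/
theorem IsConsecutive.eq_max (hf : IsConsecutive (Function.support f)) (h0 : 0 ≤ f)
    (k : Fin (c + 1)) :
    f k = max 0 (∑ j, f j - |moment (c + 1) f - (k : ℕ) * ∑ j, f j|) := by
  obtain ⟨m, hm⟩ := hf
  have lower := sum_ite_eq_lower hm
  have upper := sum_ite_eq_upper hm
  have term_nonneg : ∀ n (j : Fin (c + 1)), 0 ≤ if (j : ℕ) = n then f j else 0 := fun n j => by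
    split_ifs
    exacts [h0 j, le_rfl]
  have lower_nonneg := lower ▸ Finset.sum_nonneg fun j _ => term_nonneg m j
  have upper_nonneg := upper ▸ Finset.sum_nonneg fun j _ => term_nonneg (m + 1) j
  have sum_ite (n : ℕ) (hn : (k : ℕ) = n) :
      ∑ j : Fin (c + 1), (if (j : ℕ) = n then f j else 0) = f k := by
    simp [← hn, Fin.val_inj]
  have eq_zero (h : (k : ℕ) ≠ m ∧ (k : ℕ) ≠ m + 1) : f k = 0 := by
    by_contra hk
    exact (hm k hk).elim h.1 h.2
  set T := ∑ j, f j
  set H := moment (c + 1) f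
  rcases (by omega : (k : ℕ) < m ∨ (k : ℕ) = m ∨ (k : ℕ) = m + 1 ∨ m + 1 < k) with hk | hk | hk | hk
  · have : ((k : ℕ) : ℝ) + 1 ≤ m := by exact_mod_cast hk
    rw [eq_zero (by omega), max_eq_left]
    nlinarith [le_abs_self (H - (k : ℕ) * T)]
  · have := lower ▸ sum_ite m hk
    rw [hk, abs_of_nonneg upper_nonneg, max_eq_right] <;>
      linarith [show 0 ≤ f k from h0 k]
  · have := upper ▸ sum_ite (m + 1) hk
    rw [hk, Nat.cast_succ, abs_of_nonpos, max_eq_right] <;>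
      linarith [show 0 ≤ f k from h0 k]
  · have : (m : ℝ) + 1 + 1 ≤ (k : ℕ) := by exact_mod_cast hk
    rw [eq_zero (by omega), max_eq_left]
    nlinarith [neg_abs_le (H - (k : ℕ) * T)]

theorem IsConsecutive.eq_of_moment_eq (hf : IsConsecutive (Function.support f)) (hf0 : 0 ≤ f)
    (hg : IsConsecutive (Function.support g)) (hg0 : 0 ≤ g) (hsum : ∑ k, f k = ∑ k, g k)
    (hmoment : moment (c + 1) f = moment (c + 1) g) : f = g := by
  ext k
  rw [hf.eq_max hf0, hg.eq_max hg0, hsum, hmoment]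

theorem IsConsecutive.mem_integerLattice (hf : IsConsecutive (Function.support f)) (h0 : 0 ≤ f)
    (hsum : ∑ k, f k ∈ intLattice) (hmoment : moment (c + 1) f ∈ intLattice) :
    f ∈ integerLattice (Fin (c + 1)) := by
  refine _root_.mem_integerLattice.2 fun k => ?_
  have distance_mem : |moment (c + 1) f - (k : ℕ) * ∑ j, f j| ∈ intLattice :=
    abs_mem_iff.2 (sub_mem hmoment (smul_mem_of_mem_intLattice (natCast_mem_intLattice k) hsum))
  rw [hf.eq_max h0]
  rcases max_choice 0 (∑ j, f j - |moment (c + 1) f - (k : ℕ) * ∑ j, f j|) with h | h <;> rw [h]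
  exacts [intLattice.zero_mem, sub_mem hsum distance_mem]

theorem exists_isConsecutive (c : ℕ) {T H : ℝ} (hT : 0 ≤ T) (hH : 0 ≤ H) (hle : H ≤ c * T) :
    ∃ f : Fin (c + 1) → ℝ, 0 ≤ f ∧ IsConsecutive (Function.support f) ∧ ∑ k, f k = T ∧
      moment (c + 1) f = H := by
  rcases hle.eq_or_lt with rfl | hlt
  · refine ⟨Pi.single (Fin.last c) T, Pi.single_nonneg.2 hT, ⟨c, fun k hk => .inl ?_⟩,
      by simp, by simp [moment, mul_comm]⟩
    rw [Pi.support_single_subset hk, Fin.val_last]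
  · have hT : 0 < T := by
      by_contra h
      nlinarith [(Nat.cast_nonneg c : (0 : ℝ) ≤ c)]
    obtain ⟨m, hm⟩ : ∃ m : Fin c, (m : ℕ) = ⌊H / T⌋₊ :=
      ⟨⟨_, (Nat.floor_lt (by positivity)).2 ((div_lt_iff₀ hT).2 hlt)⟩, rfl⟩
    have hlow : (m : ℕ) * T ≤ H := by
      rw [hm, ← le_div_iff₀ hT]
      exact Nat.floor_le (by positivity)
    have hupp : H ≤ ((m : ℕ) + 1) * T := by
      rw [hm, ← div_le_iff₀ hT]
      exact (Nat.lt_floor_add_one _).le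
    refine ⟨Pi.single m.castSucc (((m : ℕ) + 1) * T - H) + Pi.single m.succ (H - (m : ℕ) * T),
      add_nonneg (Pi.single_nonneg.2 (sub_nonneg.2 hupp)) (Pi.single_nonneg.2 (sub_nonneg.2 hlow)),
      ⟨m, fun k hk => ?_⟩, ?_, ?_⟩
    · refine (Function.support_add _ _ hk).imp (fun h => ?_) fun h => ?_ <;>
        rw [Pi.support_single_subset h] <;> simp
    · simp only [Pi.add_apply, Finset.sum_add_distrib, Finset.sum_pi_single', Finset.mem_univ,
        ↓reduceIte]
      ring
    · simp only [moment, map_add, Fintype.linearCombination_apply_single, Fin.val_castSucc,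
        Fin.val_succ, smul_eq_mul, Nat.cast_add, Nat.cast_one]
      ring

end Column

section Staircase

variable {ι : Type*} {c : ι → ℕ} {w w' : (Σ i, Fin (c i + 1)) → ℝ}

/-- The total weight of each column of a weight function on the heights `0, …, c i`. -/
def columnSum (w : (Σ i, Fin (c i + 1)) → ℝ) (i : ι) : ℝ := ∑ k, w ⟨i, k⟩

/-- The moment of each column of a weight function on the heights `0, …, c i`. -/
def columnMoment (w : (Σ i, Fin (c i + 1)) → ℝ) (i : ι) : ℝ :=
  moment (c i + 1) fun k => w ⟨i, k⟩

theorem columnSum_nonneg (hw : 0 ≤ w) : 0 ≤ columnSum w :=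
  fun _ => Finset.sum_nonneg fun _ _ => hw _

theorem support_columnSum_subset (w : (Σ i, Fin (c i + 1)) → ℝ) :
    Function.support (columnSum w) ⊆ Sigma.fst '' Function.support w := fun i hi =>
  have ⟨k, _, hk⟩ := Finset.exists_ne_zero_of_sum_ne_zero hi
  ⟨⟨i, k⟩, hk, rfl⟩

theorem image_support_subset_support_columnSum (hw : 0 ≤ w) :
    Sigma.fst '' Function.support w ⊆ Function.support (columnSum w) := by
  rintro _ ⟨⟨i, k⟩, hk, rfl⟩ h
  exact hk ((Finset.sum_eq_zero_iff_of_nonneg fun k _ => hw ⟨i, k⟩).1 h k (Finset.mem_univ k))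

theorem columnMoment_nonneg (hw : 0 ≤ w) : 0 ≤ columnMoment w :=
  fun _ => moment_nonneg fun _ => hw _

theorem columnMoment_le (hw : 0 ≤ w) (i : ι) :
    columnMoment w i ≤ c i * columnSum w i :=
  moment_le fun _ => hw _

variable [LinearOrder ι]

/-- A set of pairs (column, height) as used by weights that fill the columns `0, …, c i` one after
the other, each at two consecutive heights. -/
structure IsStaircase (s : Set (Σ i, Fin (c i + 1))) : Prop where
  ordered : ∀ x ∈ s, ∀ y ∈ s, x.1 < y.1 → (x.2 : ℕ) = c x.1 ∨ (y.2 : ℕ) = 0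
  consecutive : ∀ i, IsConsecutive {k | (⟨i, k⟩ : Σ i, Fin (c i + 1)) ∈ s}

theorem isStaircase_empty : IsStaircase (∅ : Set (Σ i, Fin (c i + 1))) :=
  ⟨by simp, fun _ => ⟨0, by simp⟩⟩

theorem IsStaircase.mono {s t : Set (Σ i, Fin (c i + 1))} (ht : IsStaircase t) (hst : s ⊆ t) :
    IsStaircase s where
  ordered x hx y hy := ht.ordered x (hst hx) y (hst hy)
  consecutive i := (ht.consecutive i).imp fun _ hm k hk => hm k (hst hk)

theorem IsStaircase.isGreedy (hs : IsStaircase (Function.support w)) (hw : 0 ≤ w) :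
    IsGreedy (fun i => c i * columnSum w i) (columnMoment w) where
  nonneg := columnMoment_nonneg hw
  le := columnMoment_le hw
  full_or_empty i j hij := by
    by_cases h : ∀ k, w ⟨i, k⟩ ≠ 0 → (k : ℕ) = c i
    · left
      rw [columnMoment, columnSum, moment_apply, mul_comm, Finset.sum_mul]
      refine Finset.sum_congr rfl fun k _ => ?_
      by_cases hk : w ⟨i, k⟩ = 0
      · simp [hk]
      · rw [h k hk]
    · right
      push Not at h
      obtain ⟨k, hk, hkc⟩ := h
      rw [columnMoment, moment_apply]
      refine Finset.sum_eq_zero fun l _ => ?_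
      by_cases hl : w ⟨j, l⟩ = 0
      · rw [hl, zero_mul]
      · rw [(hs.ordered ⟨i, k⟩ hk ⟨j, l⟩ hl hij).resolve_left hkc, Nat.cast_zero, mul_zero]

variable [Fintype ι]

theorem IsStaircase.eq_of_columnSum_eq (hs : IsStaircase (Function.support w)) (hw : 0 ≤ w)
    (hs' : IsStaircase (Function.support w')) (hw' : 0 ≤ w')
    (hsum : columnSum w = columnSum w')
    (hmoment : ∑ i, columnMoment w i = ∑ i, columnMoment w' i) : w = w' := by
  have moment_eq : columnMoment w = columnMoment w' :=
    (hs.isGreedy hw).eq_of_sum_eq (hsum ▸ hs'.isGreedy hw') hmoment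
  funext ⟨i, k⟩
  exact congrFun ((hs.consecutive i).eq_of_moment_eq (fun _ => hw _) (hs'.consecutive i)
    (fun _ => hw' _) (congrFun hsum i) (congrFun moment_eq i)) k

theorem IsStaircase.mem_integerLattice (hs : IsStaircase (Function.support w)) (hw : 0 ≤ w)
    (hsum : columnSum w ∈ integerLattice ι) (hmoment : ∑ i, columnMoment w i ∈ intLattice) :
    w ∈ integerLattice _ := by
  rw [_root_.mem_integerLattice] at hsum ⊢
  have moment_mem := _root_.mem_integerLattice.1 <| (hs.isGreedy hw).mem_integerLattice
    (_root_.mem_integerLattice.2 fun i =>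
      smul_mem_of_mem_intLattice (natCast_mem_intLattice (c i)) (hsum i)) hmoment
  rintro ⟨i, k⟩
  exact _root_.mem_integerLattice.1 ((hs.consecutive i).mem_integerLattice (fun _ => hw _)
    (hsum i) (moment_mem i)) k

theorem exists_isStaircase (c : ι → ℕ) {l : ι → ℝ} (hl : 0 ≤ l) {h : ℝ} (h0 : 0 ≤ h)
    (hle : h ≤ ∑ i, c i * l i) :
    ∃ w : (Σ i, Fin (c i + 1)) → ℝ, 0 ≤ w ∧ IsStaircase (Function.support w) ∧
      columnSum w = l ∧ ∑ i, columnMoment w i = h := by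
  obtain ⟨x, hx, hxh⟩ := exists_isGreedy (fun i => mul_nonneg (Nat.cast_nonneg (c i)) (hl i)) h0 hle
  choose f hf0 hfc hfl hfx using fun i => exists_isConsecutive (c i) (hl i) (hx.nonneg i) (hx.le i)
  refine ⟨fun y => f y.1 y.2, fun y => hf0 _ _, ⟨?_, hfc⟩, funext hfl, ?_⟩
  · rintro ⟨i, k⟩ hk ⟨j, k'⟩ hk' hij
    exact (hx.full_or_empty hij).imp
      (fun h => eq_top_of_moment_eq (hf0 i) (by rw [hfx, h, hfl]) hk)
      fun h => eq_zero_of_moment_eq_zero (hf0 j) (by rw [hfx, h]) hk'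
  · simp only [columnMoment, hfx, hxh]

end Staircase

section Fan

variable {ι : Type*}

/-- The nonnegative weights on `ι` whose support is a face. -/
def faceWeights (F : Set (Set ι)) : Set (ι → ℝ) := {w | 0 ≤ w ∧ Function.support w ∈ F}

/-- A finite unimodular fan in `M`, with respect to the lattice `L`, presented by finitely many ray
generators and the sets of rays that span its cones: distinct cones meet along common faces, which
is encoded by the uniqueness of the weights of a point, and the generators of each cone form a
lattice basis of its span, which is encoded by the integrality of the weights of lattice points. A
ray need not span a cone of the fan. -/
structure UnimodularFan {M : Type v} [AddCommGroup M] [Module ℝ M] (L : AddSubgroup M) where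
  /-- The index set of the rays. -/
  Ray : Type u
  [fintypeRay : Fintype Ray]
  /-- The primitive generators of the rays. -/
  gen : Ray → M
  /-- The sets of rays that span a cone. -/
  faces : Set (Set Ray)
  empty_mem : ∅ ∈ faces
  isLowerSet : IsLowerSet faces
  gen_mem : ∀ i, gen i ∈ L
  injOn : Set.InjOn (Fintype.linearCombination ℝ gen) (faceWeights faces)
  integral : ∀ w ∈ faceWeights faces, Fintype.linearCombination ℝ gen w ∈ L →
    w ∈ integerLattice Ray

attribute [instance] UnimodularFan.fintypeRay

namespace UnimodularFan

variable {M M' : Type*} [AddCommGroup M] [Module ℝ M] [AddCommGroup M'] [Module ℝ M']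
  {L : AddSubgroup M} {L' : AddSubgroup M'} (F : UnimodularFan.{u} L)

/-- The point of `M` with the given weights. -/
def point : (F.Ray → ℝ) →ₗ[ℝ] M := Fintype.linearCombination ℝ F.gen

/-- The support of a fan, the union of its cones. -/
def cone : Set M := F.point '' faceWeights F.faces

variable {F}

theorem support_mem_faces {w w' : F.Ray → ℝ} (h : ∀ i, w i = 0 → w' i = 0)
    (hw : Function.support w ∈ F.faces) : Function.support w' ∈ F.faces :=
  F.isLowerSet (fun i hi hwi => hi (h i hwi)) hw

theorem gen_mem_cone {i : F.Ray} (hi : {i} ∈ F.faces) : F.gen i ∈ F.cone := by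
  classical
  exact ⟨Pi.single i 1, ⟨Pi.single_nonneg.2 zero_le_one,
    F.isLowerSet Pi.support_single_subset hi⟩, by simp [point]⟩

theorem eq_zero_of_point_eq_zero {w : F.Ray → ℝ} (hw : Function.support w ∈ F.faces)
    (h : F.point w = 0) : w = 0 := by
  have posPart_mem : w⁺ ∈ faceWeights F.faces :=
    ⟨posPart_nonneg w, support_mem_faces (fun i hi => by simp [hi]) hw⟩
  have negPart_mem : w⁻ ∈ faceWeights F.faces :=
    ⟨negPart_nonneg w, support_mem_faces (fun i hi => by simp [hi]) hw⟩
  rw [← posPart_sub_negPart w, map_sub, sub_eq_zero] at h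
  rw [← posPart_sub_negPart w, F.injOn posPart_mem negPart_mem h, sub_self]

/-- Adding integer multiples of the generators reduces to nonnegative weights. -/
theorem mem_integerLattice_of_point_mem {w : F.Ray → ℝ} (hw : Function.support w ∈ F.faces)
    (h : F.point w ∈ L) : w ∈ integerLattice F.Ray := by
  let N : F.Ray → ℝ := fun i => ⌈|w i|⌉
  have N_mem : N ∈ integerLattice F.Ray := mem_integerLattice.2 fun i => ⟨_, rfl⟩
  refine ((integerLattice F.Ray).add_mem_cancel_right N_mem).1 (F.integral _ ⟨fun i => ?_, ?_⟩ ?_)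
  · have := (neg_abs_le (w i)).trans' (neg_le_neg (Int.le_ceil |w i|))
    simpa [N, neg_le_iff_add_nonneg, add_comm] using this
  · exact support_mem_faces (fun i hi => by simp [N, hi]) hw
  · rw [map_add]
    exact L.add_mem h (linearCombination_mem N_mem F.gen_mem)

/-- The fan `F` maps to `F'` under `g`: the generators of every cone are sent to generators of a
common cone. -/
def LiesOver (g : M →ₗ[ℝ] M') (F : UnimodularFan.{u} L) (F' : UnimodularFan.{v} L') : Prop :=
  ∀ s ∈ F.faces, ∃ t ∈ F'.faces, (g ∘ F.gen) '' s ⊆ F'.gen '' t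

section Map

variable (F) (g : M →ₗ[ℝ] M') (hg : ∀ x ∈ L, g x ∈ L') (hinj : Set.InjOn g F.cone)
  (hL : ∀ x ∈ F.cone, g x ∈ L' → x ∈ L)

theorem linearCombination_comp_gen (w : F.Ray → ℝ) :
    Fintype.linearCombination ℝ (g ∘ F.gen) w = g (F.point w) := by
  simp [point, Fintype.linearCombination_apply]

/-- The image of a fan under a linear map that is injective and reflects lattice points on it. -/
def map : UnimodularFan.{u} L' where
  Ray := F.Ray
  gen := g ∘ F.gen
  faces := F.faces
  empty_mem := F.empty_mem
  isLowerSet := F.isLowerSet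
  gen_mem i := hg _ (F.gen_mem i)
  injOn w hw w' hw' h := by
    simp only [linearCombination_comp_gen] at h
    exact F.injOn hw hw' (hinj ⟨w, hw, rfl⟩ ⟨w', hw', rfl⟩ h)
  integral w hw h := by
    rw [linearCombination_comp_gen] at h
    exact F.integral w hw (hL _ ⟨w, hw, rfl⟩ h)

theorem cone_map : (F.map g hg hinj hL).cone = g '' F.cone := by
  rw [cone, cone, Set.image_image]
  exact Set.image_congr fun w _ => F.linearCombination_comp_gen g w

end Map

section Restrict

variable (F) {C : Set M} (hC0 : 0 ∈ C)

/-- The subfan of the cones contained in `C`. -/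
def restrict : UnimodularFan.{u} L where
  __ := F
  faces := {s ∈ F.faces | ∀ w : F.Ray → ℝ, 0 ≤ w → Function.support w ⊆ s → F.point w ∈ C}
  empty_mem := ⟨F.empty_mem, fun w _ hw => by
    rwa [Function.support_eq_empty_iff.1 (Set.subset_empty_iff.1 hw), map_zero]⟩
  isLowerSet _ _ hts hs := ⟨F.isLowerSet hts hs.1, fun w hw hwt => hs.2 w hw (hwt.trans hts)⟩
  injOn w hw w' hw' := F.injOn ⟨hw.1, hw.2.1⟩ ⟨hw'.1, hw'.2.1⟩
  integral w hw := F.integral w ⟨hw.1, hw.2.1⟩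

/-- If a point with weights `w` lies in `C`, then so does every point of the cone spanned by the
support of `w`: a large multiple of the former is the sum of the latter and another point. -/
theorem cone_restrict (hsmul : ∀ r : ℝ, 0 ≤ r → ∀ x ∈ C, r • x ∈ C)
    (hadd : ∀ x ∈ F.cone, ∀ y ∈ F.cone, x + y ∈ C → x ∈ C) :
    (F.restrict hC0).cone = F.cone ∩ C := by
  ext x
  constructor
  · rintro ⟨w, ⟨hw, hwF⟩, rfl⟩
    exact ⟨⟨w, ⟨hw, hwF.1⟩, rfl⟩, hwF.2 w hw subset_rfl⟩
  · rintro ⟨⟨w, ⟨hw, hwF⟩, rfl⟩, hwC⟩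
    refine ⟨w, ⟨hw, hwF, fun w' hw' hsub => ?_⟩, rfl⟩
    have w'_eq_zero : ∀ i, w i = 0 → w' i = 0 := fun i hi => by_contra fun h => hsub h hi
    have ratio_nonneg : ∀ i, 0 ≤ w' i / w i := fun i => div_nonneg (hw' i) (hw i)
    let r : ℝ := ∑ i, w' i / w i
    have w'_le : w' ≤ r • w := fun i => by
      by_cases hi : w i = 0
      · simp [w'_eq_zero i hi, hi]
      · calc w' i = w' i / w i * w i := (div_mul_cancel₀ _ hi).symm
          _ ≤ r * w i := mul_le_mul_of_nonneg_right
            (Finset.single_le_sum (fun i _ => ratio_nonneg i) (Finset.mem_univ i)) (hw i)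
    refine hadd _ ⟨w', ⟨hw', F.isLowerSet hsub hwF⟩, rfl⟩ (F.point (r • w - w'))
      ⟨_, ⟨sub_nonneg.2 w'_le, support_mem_faces (fun i hi => ?_) hwF⟩, rfl⟩ ?_
    · simp [w'_eq_zero i hi, hi]
    · rw [← map_add, add_sub_cancel, map_smul]
      exact hsmul r (Finset.sum_nonneg fun i _ => ratio_nonneg i) _ hwC

end Restrict

section Chimney

variable (F) (ψ : M →ₗ[ℝ] ℝ) {u : M}

/-- The number of unit steps that fit below the function `ψ` over a ray. -/
noncomputable def rayHeight (i : F.Ray) : ℕ := ⌊ψ (F.gen i)⌋₊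

/-- The lattice points on the vertical segment over a generator of `F` that lie between `0` and the
graph of `ψ`, where `u` points upwards. -/
def chimneyGen (u : M) (x : Σ i, Fin (F.rayHeight ψ i + 1)) : M :=
  F.gen x.1 + ((x.2 : ℕ) : ℝ) • u

theorem linearCombination_chimney (u : M) (w : (Σ i, Fin (F.rayHeight ψ i + 1)) → ℝ) :
    Fintype.linearCombination ℝ (F.chimneyGen ψ u) w =
      F.point (columnSum w) + (∑ i, columnMoment w i) • u := by
  simp only [point, chimneyGen, Fintype.linearCombination_apply, Fintype.sum_sigma, columnSum,
    columnMoment, moment_apply, smul_add, Finset.sum_add_distrib, Finset.sum_smul, smul_smul]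

variable {F ψ}

theorem rayHeight_eq (hψL : ∀ x ∈ L, ψ x ∈ intLattice) (hψF : ∀ x ∈ F.cone, 0 ≤ ψ x) {i : F.Ray}
    (hi : {i} ∈ F.faces) : (F.rayHeight ψ i : ℝ) = ψ (F.gen i) := by
  obtain ⟨n, hn : (n : ℝ) = _⟩ := hψL _ (F.gen_mem i)
  have nonneg : 0 ≤ n := by exact_mod_cast hn ▸ hψF _ (gen_mem_cone hi)
  lift n to ℕ using nonneg
  rw [rayHeight, ← hn, Int.cast_natCast, Nat.floor_natCast]

theorem apply_point_eq_sum_rayHeight (hψL : ∀ x ∈ L, ψ x ∈ intLattice)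
    (hψF : ∀ x ∈ F.cone, 0 ≤ ψ x) {l : F.Ray → ℝ} (hl : Function.support l ∈ F.faces) :
    ψ (F.point l) = ∑ i, F.rayHeight ψ i * l i := by
  rw [point, Fintype.linearCombination_apply, map_sum]
  refine Finset.sum_congr rfl fun i _ => ?_
  by_cases hi : l i = 0
  · simp [hi]
  · rw [rayHeight_eq hψL hψF (F.isLowerSet (by simpa using hi) hl), map_smul,
      smul_eq_mul, mul_comm]

theorem columnSum_mem_faceWeights {w : (Σ i, Fin (F.rayHeight ψ i + 1)) → ℝ} (hw : 0 ≤ w)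
    (hwF : Sigma.fst '' Function.support w ∈ F.faces) : columnSum w ∈ faceWeights F.faces :=
  ⟨columnSum_nonneg hw, F.isLowerSet (support_columnSum_subset w) hwF⟩

theorem apply_linearCombination_chimney [LinearOrder F.Ray] {ℓ : M →ₗ[ℝ] ℝ} (hℓu : ℓ u = 1)
    (hℓF : ∀ x ∈ F.cone, ℓ x = 0) {w : (Σ i, Fin (F.rayHeight ψ i + 1)) → ℝ}
    (hw : w ∈ faceWeights {s | Sigma.fst '' s ∈ F.faces ∧ IsStaircase s}) :
    ℓ (Fintype.linearCombination ℝ (F.chimneyGen ψ u) w) = ∑ i, columnMoment w i := by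
  rw [linearCombination_chimney, map_add, map_smul, hℓu,
    hℓF _ ⟨_, columnSum_mem_faceWeights hw.1 hw.2.1, rfl⟩, zero_add, smul_eq_mul, mul_one]

variable (F) (ψ) [LinearOrder F.Ray]
  (hu : u ∈ L) (ℓ : M →ₗ[ℝ] ℝ) (hℓu : ℓ u = 1) (hℓF : ∀ x ∈ F.cone, ℓ x = 0)
  (hℓL : ∀ x ∈ L, ℓ x ∈ intLattice)

/-- The fan of the region `0 ≤ h ≤ ψ x` over the cone of `F`, where `h` is the coordinate `ℓ` in
the direction `u`: its rays are the lattice points on the vertical segments over the generators of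
`F`, and its cones are spanned by staircases. -/
noncomputable def chimney : UnimodularFan L where
  Ray := Σ i, Fin (F.rayHeight ψ i + 1)
  gen := F.chimneyGen ψ u
  faces := {s | Sigma.fst '' s ∈ F.faces ∧ IsStaircase s}
  empty_mem := ⟨by simpa using F.empty_mem, isStaircase_empty⟩
  isLowerSet _ _ hts hs := ⟨F.isLowerSet (Set.image_mono hts) hs.1, hs.2.mono hts⟩
  gen_mem x := L.add_mem (F.gen_mem _) (smul_mem_of_mem_intLattice (natCast_mem_intLattice _) hu)
  injOn w hw w' hw' h := by
    have moment_eq := congrArg ℓ h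
    rw [apply_linearCombination_chimney hℓu hℓF hw,
      apply_linearCombination_chimney hℓu hℓF hw'] at moment_eq
    rw [linearCombination_chimney, linearCombination_chimney, moment_eq, add_left_inj] at h
    exact hw.2.2.eq_of_columnSum_eq hw.1 hw'.2.2 hw'.1
      (F.injOn (columnSum_mem_faceWeights hw.1 hw.2.1)
        (columnSum_mem_faceWeights hw'.1 hw'.2.1) h) moment_eq
  integral w hw h := by
    have moment_mem := hℓL _ h
    rw [apply_linearCombination_chimney hℓu hℓF hw] at moment_mem
    rw [linearCombination_chimney,
      L.add_mem_cancel_right (smul_mem_of_mem_intLattice moment_mem hu)] at h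
    exact hw.2.2.mem_integerLattice hw.1
      (F.integral _ (columnSum_mem_faceWeights hw.1 hw.2.1) h) moment_mem

variable {F ψ}

theorem cone_chimney (hψL : ∀ x ∈ L, ψ x ∈ intLattice) (hψF : ∀ x ∈ F.cone, 0 ≤ ψ x) :
    (F.chimney ψ hu ℓ hℓu hℓF hℓL).cone =
      {y | ∃ x ∈ F.cone, ∃ h : ℝ, 0 ≤ h ∧ h ≤ ψ x ∧ x + h • u = y} := by
  ext y
  constructor
  · rintro ⟨w, ⟨hw, hwF⟩, rfl⟩
    have hsum := columnSum_mem_faceWeights hw hwF.1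
    refine ⟨_, ⟨_, hsum, rfl⟩, _, Finset.sum_nonneg fun i _ => columnMoment_nonneg hw i, ?_,
      (F.linearCombination_chimney ψ u w).symm⟩
    rw [apply_point_eq_sum_rayHeight hψL hψF hsum.2]
    exact Finset.sum_le_sum fun i _ => columnMoment_le hw i
  · rintro ⟨_, ⟨l, ⟨hl, hlF⟩, rfl⟩, h, h0, hle, rfl⟩
    rw [apply_point_eq_sum_rayHeight hψL hψF hlF] at hle
    obtain ⟨w, hw, hws, rfl, rfl⟩ := exists_isStaircase _ hl h0 hle
    exact ⟨w, ⟨hw, F.isLowerSet (image_support_subset_support_columnSum hw) hlF, hws⟩,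
      F.linearCombination_chimney ψ u w⟩

theorem LiesOver.chimney {F' : UnimodularFan.{v} L'} {g : M →ₗ[ℝ] M'} (h : LiesOver g F F')
    (hgu : g u = 0) : LiesOver g (F.chimney ψ hu ℓ hℓu hℓF hℓL) F' := by
  rintro s ⟨hs, -⟩
  refine (h _ hs).imp fun t ⟨ht, hst⟩ => ⟨ht, ?_⟩
  rintro _ ⟨x, hx, rfl⟩
  refine hst ⟨x.1, Set.mem_image_of_mem _ hx, ?_⟩
  change g (F.gen x.1) = g (F.gen x.1 + ((x.2 : ℕ) : ℝ) • u)
  rw [map_add, map_smul, hgu, smul_zero, add_zero]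

end Chimney

section BelowGraph

variable {N J : Type*} [AddCommGroup N] [Module ℝ N] {L₀ : AddSubgroup N} {W : J → Type*}
  [∀ j, Fintype (W j)]

/-- The amount by which the sum of the `j`-th block of coordinates falls short of `φ j`. -/
def slack (φ : J → N →ₗ[ℝ] ℝ) (j : J) : N × ((Σ j, W j) → ℝ) →ₗ[ℝ] ℝ :=
  φ j ∘ₗ LinearMap.fst ℝ _ _ - ∑ w, LinearMap.proj ⟨j, w⟩ ∘ₗ LinearMap.snd ℝ _ _

variable {φ : J → N →ₗ[ℝ] ℝ}

theorem slack_apply (j : J) (y : N × ((Σ j, W j) → ℝ)) :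
    slack φ j y = φ j y.1 - ∑ w, y.2 ⟨j, w⟩ := by
  simp [slack]

theorem slack_mem_intLattice (hφL : ∀ j, ∀ x ∈ L₀, φ j x ∈ intLattice) (j : J)
    (y : N × ((Σ j, W j) → ℝ)) (hy : y ∈ L₀.prod (integerLattice _)) :
    slack φ j y ∈ intLattice := by
  rw [slack_apply]
  exact sub_mem (hφL j _ hy.1) (sum_mem fun w _ => mem_integerLattice.1 hy.2 _)

theorem slack_single [DecidableEq J] [∀ j, DecidableEq (W j)] (j : J) (a : Σ j, W j) :
    slack φ j (0, Pi.single a 1) = if j = a.1 then -1 else 0 := by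
  obtain ⟨k, v⟩ := a
  rw [slack_apply]
  split_ifs with h
  · subst h
    simp [Pi.single_apply]
  · simp [h]

/-- The points over `C` with nonnegative coordinates in `A`, and no others, whose blocks of
coordinates have sums at most `φ j`. -/
def belowGraph (C : Set N) (φ : J → N →ₗ[ℝ] ℝ) (A : Set (Σ j, W j)) :
    Set (N × ((Σ j, W j) → ℝ)) :=
  {y | y.1 ∈ C ∧ 0 ≤ y.2 ∧ (∀ a ∉ A, y.2 a = 0) ∧ ∀ j, 0 ≤ slack φ j y}

theorem belowGraph_empty {C : Set N} (hφC : ∀ j, ∀ x ∈ C, 0 ≤ φ j x) :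
    belowGraph C φ (∅ : Set (Σ j, W j)) = LinearMap.inl ℝ N ((Σ j, W j) → ℝ) '' C := by
  ext ⟨x, t⟩
  constructor
  · rintro ⟨hx, -, ht, -⟩
    obtain rfl : t = 0 := funext fun a => ht a (Set.notMem_empty a)
    exact ⟨x, hx, rfl⟩
  · rintro ⟨x, hx, h⟩
    obtain ⟨rfl, rfl⟩ := Prod.mk_inj.1 h
    exact ⟨hx, le_rfl, fun _ _ => rfl, fun j => by simpa [slack_apply] using hφC j x hx⟩

theorem belowGraph_insert [DecidableEq J] [∀ j, DecidableEq (W j)] (C : Set N)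
    {A : Set (Σ j, W j)} {a : Σ j, W j} (ha : a ∉ A) :
    belowGraph C φ (insert a A) =
      {z | ∃ y ∈ belowGraph C φ A, ∃ h : ℝ, 0 ≤ h ∧ h ≤ slack φ a.1 y ∧
        y + h • (0, Pi.single a 1) = z} := by
  ext z
  constructor
  · rintro ⟨hz, hz0, hzA, hzφ⟩
    have slack_sub : ∀ j, slack φ j (z - z.2 a • (0, Pi.single a 1)) =
        slack φ j z + if j = a.1 then z.2 a else 0 := fun j => by
      rw [map_sub, map_smul, slack_single]
      split_ifs <;> simp
    refine ⟨z - z.2 a • (0, Pi.single a 1), ⟨by simpa using hz, fun b => ?_, fun b hb => ?_,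
      fun j => ?_⟩, z.2 a, hz0 a, ?_, sub_add_cancel _ _⟩
    · by_cases hb : b = a
      · subst hb; simp
      · simpa [hb] using hz0 b
    · by_cases hba : b = a
      · subst hba; simp
      · simpa [hba] using hzA b (by simp [hba, hb])
    · rw [slack_sub]
      exact add_nonneg (hzφ j) (by split_ifs; exacts [hz0 a, le_rfl])
    · rw [slack_sub, if_pos rfl]
      exact le_add_of_nonneg_left (hzφ a.1)
  · rintro ⟨y, ⟨hy, hy0, hyA, hyφ⟩, h, h0, hle, rfl⟩
    refine ⟨by simpa using hy,
      add_nonneg hy0 (smul_nonneg h0 (Pi.single_nonneg.2 zero_le_one)), fun b hb => ?_, fun j => ?_⟩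
    · simp only [Set.mem_insert_iff, not_or] at hb
      simp [hb.1, hyA b hb.2]
    · rw [map_add, map_smul, slack_single]
      split_ifs with hj
      · subst hj
        simpa using hle
      · simpa using hyφ j

theorem exists_cone_eq_belowGraph [Finite J] (F₀ : UnimodularFan.{u} L₀)
    (hφL : ∀ j, ∀ x ∈ L₀, φ j x ∈ intLattice) (hφF : ∀ j, ∀ x ∈ F₀.cone, 0 ≤ φ j x)
    (A : Finset (Σ j, W j)) :
    ∃ F : UnimodularFan.{u} (L₀.prod (integerLattice (Σ j, W j))),
      F.cone = belowGraph F₀.cone φ A ∧ LiesOver (LinearMap.fst ℝ _ _) F F₀ := by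
  classical
  induction A using Finset.induction_on with
  | empty =>
    have inl_mem : ∀ x ∈ L₀, LinearMap.inl ℝ N ((Σ j, W j) → ℝ) x ∈ L₀.prod (integerLattice _) :=
      fun x hx => AddSubgroup.mem_prod.2 ⟨hx, zero_mem _⟩
    have inl_reflects : ∀ x ∈ F₀.cone, LinearMap.inl ℝ N ((Σ j, W j) → ℝ) x ∈
        L₀.prod (integerLattice _) → x ∈ L₀ := fun x _ hx => (AddSubgroup.mem_prod.1 hx).1
    refine ⟨F₀.map _ inl_mem LinearMap.inl_injective.injOn inl_reflects, ?_,
      fun s hs => ⟨s, hs, subset_rfl⟩⟩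
    rw [cone_map, Finset.coe_empty, belowGraph_empty hφF]
  | insert a A ha ih =>
    obtain ⟨F, hF, hFF₀⟩ := ih
    obtain ⟨_⟩ : Nonempty (LinearOrder F.Ray) := ⟨linearOrderOfSTO WellOrderingRel⟩
    have u_mem : ((0, Pi.single a 1) : N × ((Σ j, W j) → ℝ)) ∈ L₀.prod (integerLattice _) :=
      AddSubgroup.mem_prod.2 ⟨zero_mem _, single_one_mem_integerLattice a⟩
    obtain ⟨ℓ, hℓ⟩ : ∃ ℓ : N × ((Σ j, W j) → ℝ) →ₗ[ℝ] ℝ, ∀ y, ℓ y = y.2 a :=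
      ⟨LinearMap.proj a ∘ₗ LinearMap.snd ℝ _ _, fun _ => rfl⟩
    refine ⟨F.chimney (slack φ a.1) u_mem ℓ ((hℓ _).trans (Pi.single_eq_same a 1))
      (fun y hy => (hℓ y).trans ((hF ▸ hy).2.2.1 a ha))
      (fun y hy => hℓ y ▸ mem_integerLattice.1 (AddSubgroup.mem_prod.1 hy).2 a), ?_,
      hFF₀.chimney _ _ _ _ _ (by simp)⟩
    rw [cone_chimney _ _ _ _ _ (slack_mem_intLattice hφL a.1)
      (fun y hy => (hF ▸ hy).2.2.2 a.1), Finset.coe_insert, hF,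
      belowGraph_insert _ (mt Finset.mem_coe.1 ha)]

end BelowGraph

section FibreProduct

variable {N J : Type*} [AddCommGroup N] [Module ℝ N] {L₀ : AddSubgroup N} {N' : J → Type*}
  [∀ j, AddCommGroup (N' j)] [∀ j, Module ℝ (N' j)] {L' : ∀ j, AddSubgroup (N' j)}
  (T : ∀ j, UnimodularFan (L' j)) (φ : J → N →ₗ[ℝ] ℝ)

/-- The points whose `j`-th block of coordinates consists of the weights of a point of the cone of
`T j` and has sum `φ j`. -/
def tightBlocks : Set (N × ((Σ j, (T j).Ray) → ℝ)) :=
  {y | ∀ j, (fun a => y.2 ⟨j, a⟩) ∈ faceWeights (T j).faces ∧ slack φ j y = 0}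

/-- The map that replaces each block of coordinates by the point with these weights. -/
def blockPoint : N × ((Σ j, (T j).Ray) → ℝ) →ₗ[ℝ] N × ∀ j, N' j :=
  LinearMap.id.prodMap <| LinearMap.pi fun j =>
    (T j).point ∘ₗ LinearMap.funLeft ℝ ℝ fun a => (⟨j, a⟩ : Σ j, (T j).Ray)

theorem blockPoint_apply (y : N × ((Σ j, (T j).Ray) → ℝ)) :
    blockPoint T y = (y.1, fun j => (T j).point fun a => y.2 ⟨j, a⟩) := rfl

variable {T φ}

theorem zero_mem_tightBlocks : 0 ∈ tightBlocks T φ := fun j =>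
  ⟨⟨le_rfl, by simpa using (T j).empty_mem⟩, map_zero _⟩

theorem smul_mem_tightBlocks {r : ℝ} (hr : 0 ≤ r) {y : N × ((Σ j, (T j).Ray) → ℝ)}
    (hy : y ∈ tightBlocks T φ) : r • y ∈ tightBlocks T φ := fun j =>
  ⟨⟨smul_nonneg hr (hy j).1.1, support_mem_faces (fun a ha => by simp_all) (hy j).1.2⟩,
    by rw [map_smul, (hy j).2, smul_zero]⟩

theorem mem_tightBlocks_of_add_mem {C : Set N} {A : Set (Σ j, (T j).Ray)}
    {x y : N × ((Σ j, (T j).Ray) → ℝ)} (hx : x ∈ belowGraph C φ A) (hy : y ∈ belowGraph C φ A)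
    (hxy : x + y ∈ tightBlocks T φ) : x ∈ tightBlocks T φ := by
  refine fun j => ⟨⟨fun a => hx.2.1 _, support_mem_faces (fun a ha => ?_) (hxy j).1.2⟩, ?_⟩
  · exact ((add_eq_zero_iff_of_nonneg (hx.2.1 ⟨j, a⟩) (hy.2.1 ⟨j, a⟩)).1 ha).1
  · exact ((add_eq_zero_iff_of_nonneg (hx.2.2.2 j) (hy.2.2.2 j)).1
      ((map_add _ _ _).symm.trans (hxy j).2)).1

theorem injOn_blockPoint : Set.InjOn (blockPoint T) (tightBlocks T φ) := by
  intro y hy y' hy' h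
  obtain ⟨h1, h2⟩ := Prod.mk_inj.1 h
  exact Prod.ext h1 (funext fun ⟨j, a⟩ =>
    congrFun ((T j).injOn (hy j).1 (hy' j).1 (congrFun h2 j)) a)

theorem blockPoint_mem {y : N × ((Σ j, (T j).Ray) → ℝ)} (hy : y ∈ L₀.prod (integerLattice _)) :
    blockPoint T y ∈ L₀.prod (AddSubgroup.pi Set.univ L') := by
  obtain ⟨hy1, hy2⟩ := AddSubgroup.mem_prod.1 hy
  exact AddSubgroup.mem_prod.2 ⟨hy1, fun j _ => linearCombination_mem
    (mem_integerLattice.2 fun a => mem_integerLattice.1 hy2 ⟨j, a⟩) (T j).gen_mem⟩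

theorem mem_of_blockPoint_mem {y : N × ((Σ j, (T j).Ray) → ℝ)} (hy : y ∈ tightBlocks T φ)
    (h : blockPoint T y ∈ L₀.prod (AddSubgroup.pi Set.univ L')) :
    y ∈ L₀.prod (integerLattice _) := by
  obtain ⟨h1, h2⟩ := AddSubgroup.mem_prod.1 h
  exact AddSubgroup.mem_prod.2 ⟨h1, mem_integerLattice.2 fun ⟨j, a⟩ =>
    mem_integerLattice.1 ((T j).integral _ (hy j).1 (h2 j (Set.mem_univ j))) a⟩

variable {δ : ∀ j, N' j →ₗ[ℝ] ℝ}

theorem apply_point_eq_sum (hδ : ∀ j a, δ j ((T j).gen a) = 1) (j : J) (w : (T j).Ray → ℝ) :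
    δ j ((T j).point w) = ∑ a, w a := by
  simp [point, Fintype.linearCombination_apply, hδ]

theorem image_blockPoint (hδ : ∀ j a, δ j ((T j).gen a) = 1) (C : Set N) :
    blockPoint T '' (belowGraph C φ Set.univ ∩ tightBlocks T φ) =
      {y | y.1 ∈ C ∧ ∀ j, y.2 j ∈ (T j).cone ∧ δ j (y.2 j) = φ j y.1} := by
  ext ⟨x, z⟩
  constructor
  · rintro ⟨y, ⟨hyC, hy⟩, h⟩
    rw [← h, blockPoint_apply]
    refine ⟨hyC.1, fun j => ⟨⟨_, (hy j).1, rfl⟩, ?_⟩⟩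
    rw [apply_point_eq_sum hδ]
    exact (sub_eq_zero.1 ((slack_apply j y).symm.trans (hy j).2)).symm
  · rintro ⟨hx, hz⟩
    choose t ht htz using fun j => (hz j).1
    have slack_eq : ∀ j, slack φ j (x, fun a : Σ j, (T j).Ray => t a.1 a.2) = 0 := fun j => by
      rw [slack_apply, sub_eq_zero, ← apply_point_eq_sum hδ, htz, (hz j).2]
    exact ⟨(x, fun a => t a.1 a.2), ⟨⟨hx, fun a => (ht a.1).1 a.2,
      fun a ha => absurd (Set.mem_univ a) ha, fun j => (slack_eq j).ge⟩,
      fun j => ⟨ht j, slack_eq j⟩⟩, Prod.ext rfl (funext htz)⟩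

theorem exists_cone_eq_fibreProduct [Finite J] (F₀ : UnimodularFan.{u} L₀)
    (hφL : ∀ j, ∀ x ∈ L₀, φ j x ∈ intLattice) (hφF : ∀ j, ∀ x ∈ F₀.cone, 0 ≤ φ j x)
    (hδ : ∀ j a, δ j ((T j).gen a) = 1) :
    ∃ F : UnimodularFan.{u} (L₀.prod (AddSubgroup.pi Set.univ L')),
      F.cone = {y | y.1 ∈ F₀.cone ∧ ∀ j, y.2 j ∈ (T j).cone ∧ δ j (y.2 j) = φ j y.1} ∧
      LiesOver (LinearMap.fst ℝ _ _) F F₀ := by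
  obtain ⟨_⟩ := nonempty_fintype J
  obtain ⟨F, hF, hFF₀⟩ :=
    exists_cone_eq_belowGraph F₀ hφL hφF (Finset.univ : Finset (Σ j, (T j).Ray))
  have zero_mem : 0 ∈ tightBlocks T φ := zero_mem_tightBlocks
  have cone_eq : (F.restrict zero_mem).cone =
      belowGraph F₀.cone φ Set.univ ∩ tightBlocks T φ := by
    rw [cone_restrict _ _ (fun _ hr _ => smul_mem_tightBlocks hr)
      (fun x hx y hy => mem_tightBlocks_of_add_mem (hF ▸ hx) (hF ▸ hy)), hF, Finset.coe_univ]
  refine ⟨(F.restrict zero_mem).map (blockPoint T) (fun _ => blockPoint_mem)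
    (injOn_blockPoint.mono (cone_eq ▸ Set.inter_subset_right))
    (fun y hy => mem_of_blockPoint_mem (cone_eq ▸ hy).2), ?_, fun s hs => hFF₀ s hs.1⟩
  rw [cone_map, cone_eq, image_blockPoint hδ]

end FibreProduct

end UnimodularFan

end Fan

section Homogenization

variable {ι κ E V : Type*} [AddCommGroup E] [Module ℝ E] [AddCommGroup V] [Module ℝ V]
  {L : AddSubgroup V}

/-- The linear map that restricts at height `1` to the affine map `f`. -/
def homogenize (f : E →ᵃ[ℝ] V) : E × ℝ →ₗ[ℝ] V :=
  f.linear.coprod (LinearMap.toSpanSingleton ℝ V (f 0))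

theorem homogenize_apply (f : E →ᵃ[ℝ] V) (x : E) (r : ℝ) :
    homogenize f (x, r) = f x + (r - 1) • f 0 := by
  have := congrFun f.decomp x
  simp only [Pi.add_apply] at this
  rw [this]
  simp only [homogenize, LinearMap.coprod_apply, LinearMap.toSpanSingleton_apply]
  module

theorem homogenize_one (f : E →ᵃ[ℝ] V) (x : E) : homogenize f (x, 1) = f x := by
  rw [homogenize_apply, sub_self, zero_smul, add_zero]

theorem homogenize_mem_iff {f : E →ᵃ[ℝ] V} (hf : f 0 ∈ L) {r : ℝ} (hr : r ∈ intLattice) (x : E) :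
    homogenize f (x, r) ∈ L ↔ f x ∈ L := by
  rw [homogenize_apply]
  exact L.add_mem_cancel_right (smul_mem_of_mem_intLattice
    (intLattice.sub_mem hr (by simpa using natCast_mem_intLattice 1)) hf)

/-- The linear combination of the points `(p i, 1)` with the given weights. -/
def homogeneousPoint [Fintype ι] (p : ι → V) : (ι → ℝ) →ₗ[ℝ] V × ℝ :=
  Fintype.linearCombination ℝ fun i => (p i, (1 : ℝ))

theorem homogeneousPoint_apply [Fintype ι] (p : ι → V) (w : ι → ℝ) :
    homogeneousPoint p w = (∑ i, w i • p i, ∑ i, w i) := by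
  simp [homogeneousPoint, Fintype.linearCombination_apply, Prod.ext_iff, Prod.fst_sum,
    Prod.snd_sum]

theorem homogeneousPoint_comp [Fintype ι] [Fintype κ] {j : κ → ι} (hj : Function.Injective j)
    (p : ι → V) {w : ι → ℝ} (hw : Function.support w ⊆ Set.range j) :
    homogeneousPoint (p ∘ j) (w ∘ j) = homogeneousPoint p w := by
  refine Fintype.sum_of_injective j hj _ _ (fun i hi => ?_) fun i => rfl
  rw [Function.notMem_support.1 fun h => hi (hw h), zero_smul]

theorem mem_convexHull_image_iff [Fintype ι] {p : ι → V} {s : Set ι} {x : V} {r : ℝ}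
    (hr : 0 < r) : x ∈ convexHull ℝ (p '' s) ↔
      ∃ w : ι → ℝ, 0 ≤ w ∧ Function.support w ⊆ s ∧ homogeneousPoint p w = (r • x, r) := by
  classical
  constructor
  · refine fun hx => convexHull_min (t := {x : V | ∃ w : ι → ℝ, 0 ≤ w ∧
      Function.support w ⊆ s ∧ homogeneousPoint p w = (r • x, r)}) ?_ ?_ hx
    · rintro _ ⟨i, hi, rfl⟩
      exact ⟨Pi.single i r, Pi.single_nonneg.2 hr.le,
        Pi.support_single_subset.trans (Set.singleton_subset_iff.2 hi), by simp [homogeneousPoint]⟩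
    · rintro y ⟨w, hw, hws, h⟩ z ⟨w', hw', hws', h'⟩ a b ha hb hab
      refine ⟨a • w + b • w', add_nonneg (smul_nonneg ha hw) (smul_nonneg hb hw'),
        (Function.support_add _ _).trans (Set.union_subset
          ((Function.support_const_smul_subset a w).trans hws)
          ((Function.support_const_smul_subset b w').trans hws')), ?_⟩
      rw [map_add, map_smul, map_smul, h, h']
      exact Prod.ext (by dsimp only [Prod.fst_add, Prod.smul_fst]; module)
        (by simp [← add_mul, hab])
  · rintro ⟨w, hw, hws, h⟩
    obtain ⟨h1, h2⟩ := Prod.mk_inj.1 ((homogeneousPoint_apply p w).symm.trans h)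
    have x_eq : x = Finset.univ.centerMass w p := by
      rw [Finset.centerMass, h1, h2, inv_smul_smul₀ hr.ne']
    rw [x_eq, ← Finset.centerMass_filter_ne_zero]
    refine Finset.centerMass_mem_convexHull _ (fun i _ => hw i) ?_ fun i hi =>
      Set.mem_image_of_mem _ (hws (Finset.mem_filter.1 hi).2)
    rwa [Finset.sum_filter_ne_zero, h2]

theorem affineIndependent_iff_linearIndependent_prod {p : ι → V} :
    AffineIndependent ℝ p ↔ LinearIndependent ℝ fun i => (p i, (1 : ℝ)) := by
  rw [affineIndependent_iff, linearIndependent_iff']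
  refine forall₂_congr fun s w => ?_
  simp only [Prod.smul_mk, smul_eq_mul, mul_one, Prod.ext_iff, Prod.fst_sum, Prod.snd_sum,
    Prod.fst_zero, Prod.snd_zero]
  tauto

theorem affineIndependent_iff_homogeneousPoint [Fintype ι] {p : ι → V} {s : Set ι} :
    AffineIndependent ℝ (fun i : s => p i) ↔
      ∀ w : ι → ℝ, Function.support w ⊆ s → homogeneousPoint p w = 0 → w = 0 := by
  classical
  rw [affineIndependent_iff_linearIndependent_prod, Fintype.linearIndependent_iff]
  constructor
  · intro h w hws hw
    rw [← homogeneousPoint_comp Subtype.val_injective p (hws.trans_eq Subtype.range_coe.symm)]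
      at hw
    funext i
    by_cases hi : i ∈ s
    · exact h _ hw ⟨i, hi⟩
    · exact Function.notMem_support.1 fun h => hi (hws h)
  · intro h w hw i
    let W : ι → ℝ := Function.extend Subtype.val w 0
    have support_subset : Function.support W ⊆ Set.range Subtype.val :=
      (Function.support_extend_zero Subtype.val_injective).trans_subset
        (Set.image_subset_range _ _)
    have W_comp : W ∘ Subtype.val = w := Function.extend_comp Subtype.val_injective w 0
    have W_eq_zero : W = 0 := h W (support_subset.trans_eq Subtype.range_coe) (by
      rwa [← homogeneousPoint_comp Subtype.val_injective p support_subset, W_comp])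
    rw [← W_comp, W_eq_zero]
    rfl

end Homogenization

section Unimodular

variable {ι κ E : Type*} [AddCommGroup E] [Module ℝ E] {L : AddSubgroup E}

/-- The lattice points among the linear combinations of the points `(p i, 1)` are those with
integral weights. When finitely many distinct points have this property, they are the vertices of
a unimodular simplex. -/
def IsUnimodularFamily [Fintype ι] (L : AddSubgroup E) (p : ι → E) : Prop :=
  ∀ w : ι → ℝ, homogeneousPoint p w ∈ L.prod intLattice ↔ w ∈ integerLattice ι

theorem comp_mem_integerLattice_iff {j : κ → ι} {w : ι → ℝ}
    (hw : Function.support w ⊆ Set.range j) :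
    w ∘ j ∈ integerLattice κ ↔ w ∈ integerLattice ι := by
  simp only [mem_integerLattice, Function.comp_apply]
  refine ⟨fun h i => ?_, fun h k => h (j k)⟩
  by_cases hi : i ∈ Set.range j
  · obtain ⟨k, rfl⟩ := hi
    exact h k
  · rw [Function.notMem_support.1 fun h => hi (hw h)]
    exact zero_mem _

theorem mem_integerLattice_option [Fintype ι] {w : Option ι → ℝ} :
    w ∈ integerLattice (Option ι) ↔ w ∘ some ∈ integerLattice ι ∧ ∑ o, w o ∈ intLattice := by
  simp only [mem_integerLattice, Option.forall, Fintype.sum_option, Function.comp_apply]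
  rw [and_comm, and_congr_right_iff]
  exact fun h => (intLattice.add_mem_cancel_right (sum_mem fun i _ => h i)).symm

theorem isUnimodularFamily_comp_iff [Fintype ι] [Fintype κ] {j : κ → ι}
    (hj : Function.Injective j) {p : ι → E} :
    IsUnimodularFamily L (p ∘ j) ↔ ∀ w : ι → ℝ, Function.support w ⊆ Set.range j →
      (homogeneousPoint p w ∈ L.prod intLattice ↔ w ∈ integerLattice ι) := by
  constructor
  · intro h w hw
    rw [← homogeneousPoint_comp hj p hw, h, comp_mem_integerLattice_iff hw]
  · intro h w
    have support_subset : Function.support (Function.extend j w 0) ⊆ Set.range j :=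
      (Function.support_extend_zero hj).trans_subset (Set.image_subset_range _ _)
    rw [← Function.extend_comp hj w 0, homogeneousPoint_comp hj p support_subset,
      h _ support_subset, comp_mem_integerLattice_iff support_subset]

theorem isUnimodularFamily_comp_equiv_iff [Fintype ι] [Fintype κ] (σ : κ ≃ ι) {p : ι → E} :
    IsUnimodularFamily L (p ∘ σ) ↔ IsUnimodularFamily L p := by
  rw [isUnimodularFamily_comp_iff σ.injective]
  exact forall_congr' fun w => by simp [σ.surjective.range_eq]

theorem IsUnimodularFamily.mem [Fintype ι] {p : ι → E} (hp : IsUnimodularFamily L p) (i : ι) :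
    p i ∈ L := by
  classical
  have := (hp (Pi.single i 1)).2 (single_one_mem_integerLattice i)
  simpa [homogeneousPoint] using (AddSubgroup.mem_prod.1 this).1

theorem eq_zero_of_forall_smul_mem_integerLattice {x : ι → ℝ}
    (h : ∀ r : ℝ, r • x ∈ integerLattice ι) : x = 0 := by
  by_contra hx
  obtain ⟨i, hi⟩ := Function.ne_iff.1 hx
  obtain ⟨m, hm⟩ := mem_integerLattice.1 (h (2⁻¹ / x i)) i
  have : (m : ℝ) = 2⁻¹ := by simpa [div_mul_cancel₀ _ hi] using hm
  have : (m * 2 : ℝ) = 1 := by rw [this]; norm_num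
  norm_cast at this
  omega

variable {f : (ι → ℝ) →ᵃ[ℝ] E}

theorem injective_of_forall_apply_mem_iff (h : ∀ x, f x ∈ L ↔ x ∈ integerLattice ι) :
    Function.Injective f := by
  intro x y hxy
  refine sub_eq_zero.1 (eq_zero_of_forall_smul_mem_integerLattice fun r => (h _).1 ?_)
  have linear_eq_zero : f.linear (x - y) = 0 := by
    rw [← vsub_eq_sub, f.linearMap_vsub, hxy, vsub_self]
  have : f (r • (x - y)) = f 0 := by
    have := f.map_vadd 0 (r • (x - y))
    simpa [linear_eq_zero] using this
  rw [this]
  exact (h 0).2 (zero_mem _)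

variable [DecidableEq ι]

/-- The vertices `0` and `e i` of the standard simplex. -/
def standardVertex (o : Option ι) : ι → ℝ := o.elim 0 fun i => Pi.single i 1

theorem range_standardVertex :
    Set.range standardVertex = insert 0 (Set.range fun i : ι => (Pi.single i 1 : ι → ℝ)) :=
  Option.range_eq _

theorem injective_standardVertex : Function.Injective (standardVertex (ι := ι)) := by
  rintro (_ | i) (_ | j) h
  · rfl
  · simpa [standardVertex] using congrFun h j
  · simpa [standardVertex] using congrFun h i
  · simpa [standardVertex, Pi.single_apply] using congrFun h i

variable [Fintype ι]

theorem homogeneousPoint_comp_standardVertex (w : Option ι → ℝ) :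
    homogeneousPoint (f ∘ standardVertex) w =
      (homogenize f (w ∘ some, ∑ o, w o), ∑ o, w o) := by
  simp_rw [homogeneousPoint_apply, Function.comp_apply, ← homogenize_one, ← map_smul, ← map_sum]
  congr 2
  refine Prod.ext (funext fun i => ?_) ?_
  · simp [standardVertex, Prod.fst_sum, Finset.sum_apply, Fintype.sum_option, Pi.single_apply]
  · simp [Prod.snd_sum]

theorem isUnimodularFamily_comp_standardVertex_iff :
    IsUnimodularFamily L (f ∘ standardVertex) ↔ ∀ x, f x ∈ L ↔ x ∈ integerLattice ι := by
  have one_mem : (1 : ℝ) ∈ intLattice := by simpa using natCast_mem_intLattice 1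
  constructor
  · intro h x
    let w : Option ι → ℝ := fun o => o.elim (1 - ∑ i, x i) x
    have sum_w : ∑ o, w o = 1 := by simp [w, Fintype.sum_option]
    have point_w : homogeneousPoint (f ∘ standardVertex) w = (f x, 1) := by
      rw [homogeneousPoint_comp_standardVertex, sum_w, ← homogenize_one f x]
      rfl
    calc f x ∈ L ↔ (f x, (1 : ℝ)) ∈ L.prod intLattice := by
          rw [AddSubgroup.mem_prod, and_iff_left one_mem]
      _ ↔ w ∈ integerLattice (Option ι) := point_w ▸ h w
      _ ↔ x ∈ integerLattice ι := by
          rw [mem_integerLattice_option, sum_w, and_iff_left one_mem]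
          rfl
  · intro h w
    rw [homogeneousPoint_comp_standardVertex, mem_integerLattice_option, AddSubgroup.mem_prod,
      ← h]
    exact and_congr_left fun hw => homogenize_mem_iff ((h 0).2 (zero_mem _)) hw _

/-- The affine map that sends the vertices of the standard simplex to given points. -/
def affineMapOfVertices (p : Option ι → E) : (ι → ℝ) →ᵃ[ℝ] E :=
  (Fintype.linearCombination ℝ fun i => p (some i) - p none).toAffineMap +
    AffineMap.const ℝ _ (p none)

theorem affineMapOfVertices_comp_standardVertex (p : Option ι → E) :
    affineMapOfVertices p ∘ standardVertex = p := by
  funext o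
  cases o <;> simp [affineMapOfVertices, standardVertex]

end Unimodular

section Simplex

variable {E : Type*} [AddCommGroup E] [Module ℝ E] {L : AddSubgroup E} {s : Finset E}

theorem isUnimodularSimplex_iff_exists_equiv : IsUnimodularSimplex L s ↔
    ∃ (k : ℕ) (σ : Option (Fin k) ≃ s), IsUnimodularFamily L (((↑) : s → E) ∘ σ) := by
  simp only [IsUnimodularSimplex, ← range_standardVertex, ← Set.range_comp]
  refine exists_congr fun k => ⟨?_, ?_⟩
  · rintro ⟨f, hf, hfL, hs⟩
    exact ⟨(Equiv.ofInjective _ (hf.comp injective_standardVertex)).trans (Equiv.setCongr hs),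
      isUnimodularFamily_comp_standardVertex_iff.2 hfL⟩
  · rintro ⟨σ, hσ⟩
    rw [← affineMapOfVertices_comp_standardVertex (((↑) : s → E) ∘ σ),
      isUnimodularFamily_comp_standardVertex_iff] at hσ
    refine ⟨_, injective_of_forall_apply_mem_iff hσ, hσ, ?_⟩
    rw [affineMapOfVertices_comp_standardVertex, EquivLike.range_comp, Subtype.range_coe]

theorem isUnimodularSimplex_iff :
    IsUnimodularSimplex L s ↔ s.Nonempty ∧ IsUnimodularFamily L ((↑) : s → E) := by
  simp only [isUnimodularSimplex_iff_exists_equiv, isUnimodularFamily_comp_equiv_iff]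
  constructor
  · rintro ⟨k, σ, h⟩
    exact ⟨⟨σ none, (σ none).2⟩, h⟩
  · rintro ⟨hs, h⟩
    obtain ⟨k, hk⟩ := Nat.exists_eq_add_one.2 (Finset.card_pos.2 hs)
    exact ⟨k, Fintype.equivOfCardEq (by simp [hk]), h⟩

end Simplex

section ConeOver

variable {E : Type v} [AddCommGroup E] [Module ℝ E] {L : AddSubgroup E} {P : Set E}
  {K : Geometry.SimplicialComplex ℝ E}

/-- The faces of `K`, including the empty one, as sets of vertices. -/
def vertexSets (K : Geometry.SimplicialComplex ℝ E) : Set (Set K.vertices) :=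
  {s | s.Nonempty → ∃ f ∈ K.faces, s ⊆ (↑) ⁻¹' (f : Set E)}

theorem coe_image_coe_preimage_face {f : Finset E} (hf : f ∈ K.faces) :
    ((↑) '' ((↑) ⁻¹' (f : Set E) : Set K.vertices) : Set E) = f := by
  rw [Subtype.image_preimage_coe, Set.inter_eq_right, Geometry.SimplicialComplex.vertices_eq]
  exact Set.subset_biUnion_of_mem (u := fun s : Finset E => (s : Set E)) hf

section

variable [Fintype K.vertices]

theorem mem_convexHull_face_iff {f : Finset E} (hf : f ∈ K.faces) {x : E} {r : ℝ} (hr : 0 < r) :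
    x ∈ convexHull ℝ (f : Set E) ↔ ∃ w : K.vertices → ℝ, 0 ≤ w ∧
      Function.support w ⊆ (↑) ⁻¹' (f : Set E) ∧
      homogeneousPoint ((↑) : K.vertices → E) w = (r • x, r) := by
  rw [← mem_convexHull_image_iff hr, coe_image_coe_preimage_face hf]

theorem eq_of_homogeneousPoint_eq {f : Finset E} (hf : f ∈ K.faces) {w w' : K.vertices → ℝ}
    (hw : Function.support w ⊆ (↑) ⁻¹' (f : Set E))
    (hw' : Function.support w' ⊆ (↑) ⁻¹' (f : Set E))
    (h : homogeneousPoint ((↑) : K.vertices → E) w =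
      homogeneousPoint ((↑) : K.vertices → E) w') : w = w' := by
  have indep : AffineIndependent ℝ fun i : ((↑) ⁻¹' (f : Set E) : Set K.vertices) => (i : E) :=
    (K.indep hf).comp_embedding
      ⟨fun i : (Subtype.val ⁻¹' (f : Set E) : Set K.vertices) => (⟨i.1, i.2⟩ : f),
        fun i j hij => Subtype.ext (Subtype.ext (Subtype.ext_iff.1 hij :))⟩
  refine sub_eq_zero.1 (affineIndependent_iff_homogeneousPoint.1 indep _
    ((Function.support_sub _ _).trans (Set.union_subset hw hw')) ?_)
  rw [map_sub, h, sub_self]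

theorem injOn_homogeneousPoint_vertices :
    Set.InjOn (homogeneousPoint ((↑) : K.vertices → E)) (faceWeights (vertexSets K)) := by
  classical
  rintro w ⟨hw, hwK⟩ w' ⟨hw', hwK'⟩ h
  have sum_eq : ∑ i, w i = ∑ i, w' i := by
    simpa only [homogeneousPoint_apply] using congrArg Prod.snd h
  obtain rfl | w_ne_zero := eq_or_ne w 0
  · exact ((Fintype.sum_eq_zero_iff_of_nonneg hw').1 (by simp [← sum_eq])).symm
  · have sum_pos : 0 < ∑ i, w i := Fintype.sum_pos (hw.lt_of_ne w_ne_zero.symm)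
    have w'_ne_zero : w' ≠ 0 := fun h => by simp [sum_eq, h] at sum_pos
    obtain ⟨f, hf, hwf⟩ := hwK (Function.support_nonempty_iff.2 w_ne_zero)
    obtain ⟨f', hf', hwf'⟩ := hwK' (Function.support_nonempty_iff.2 w'_ne_zero)
    obtain ⟨x, hx⟩ : ∃ x, homogeneousPoint ((↑) : K.vertices → E) w =
        ((∑ i, w i) • x, ∑ i, w i) :=
      ⟨(∑ i, w i)⁻¹ • ∑ i, w i • (i : E), by
        rw [homogeneousPoint_apply, smul_inv_smul₀ sum_pos.ne']⟩
    have x_mem : x ∈ convexHull ℝ ((f ∩ f' : Finset E) : Set E) := by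
      rw [Finset.coe_inter, ← K.convexHull_inter_convexHull hf hf']
      exact ⟨(mem_convexHull_face_iff hf sum_pos).2 ⟨w, hw, hwf, hx⟩,
        (mem_convexHull_face_iff hf' sum_pos).2 ⟨w', hw', hwf', h ▸ hx⟩⟩
    have inter_mem : f ∩ f' ∈ K.faces := K.down_closed hf Finset.inter_subset_left
      (Finset.coe_nonempty.1 (convexHull_nonempty_iff.1 ⟨x, x_mem⟩))
    obtain ⟨b, -, hbf, hb⟩ := (mem_convexHull_face_iff inter_mem sum_pos).1 x_mem
    rw [Finset.coe_inter, Set.preimage_inter, Set.subset_inter_iff] at hbf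
    exact (eq_of_homogeneousPoint_eq hf hwf hbf.1 (hx.trans hb.symm)).trans
      (eq_of_homogeneousPoint_eq hf' hwf' hbf.2 (h.symm.trans (hx.trans hb.symm))).symm

theorem image_homogeneousPoint_faceWeights (hK : K.space.Nonempty) :
    homogeneousPoint ((↑) : K.vertices → E) '' faceWeights (vertexSets K) =
      {y | 0 ≤ y.2 ∧ y.1 ∈ y.2 • K.space} := by
  refine Set.Subset.antisymm ?_ ?_
  · rintro _ ⟨w, ⟨hw, hwK⟩, rfl⟩
    rw [homogeneousPoint_apply]
    refine ⟨Finset.sum_nonneg fun i _ => hw i, ?_⟩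
    obtain rfl | w_ne_zero := eq_or_ne w 0
    · simp [Set.zero_smul_set hK]
    · have sum_pos : 0 < ∑ i, w i := Fintype.sum_pos (hw.lt_of_ne w_ne_zero.symm)
      obtain ⟨f, hf, hwf⟩ := hwK (Function.support_nonempty_iff.2 w_ne_zero)
      rw [Set.mem_smul_set_iff_inv_smul_mem₀ sum_pos.ne']
      exact K.convexHull_subset_space hf ((mem_convexHull_face_iff hf sum_pos).2
        ⟨w, hw, hwf, by rw [homogeneousPoint_apply, smul_inv_smul₀ sum_pos.ne']⟩)
  · rintro ⟨x, r⟩ ⟨hr, y, hy, hyx⟩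
    obtain rfl : r • y = x := hyx
    obtain hr0 | hr0 := (show 0 ≤ r from hr).eq_or_lt
    · exact ⟨0, ⟨le_rfl, fun h => absurd h (by simp)⟩, by simp [← hr0, Prod.ext_iff]⟩
    · obtain ⟨f, hf, hyf⟩ := Geometry.SimplicialComplex.mem_space_iff.1 hy
      obtain ⟨w, hw, hwf, h⟩ := (mem_convexHull_face_iff hf hr0).1 hyf
      exact ⟨w, ⟨hw, fun _ => ⟨f, hf, hwf⟩⟩, h⟩

end

namespace IsUnimodularTriangulation

variable (hK : IsUnimodularTriangulation L P K)

include hK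

theorem exists_facet_superset {f : Finset E} (hf : f ∈ K.faces) : ∃ g ∈ K.facets, f ⊆ g := by
  obtain ⟨g, hfg, hg⟩ := hK.finite.exists_le_maximal hf
  exact ⟨g, ⟨hg.prop, fun t ht hgt => hgt.antisymm (hg.2 ht hgt)⟩, hfg⟩

theorem finite_vertices : K.vertices.Finite := by
  rw [Geometry.SimplicialComplex.vertices_eq]
  exact hK.finite.biUnion fun f _ => f.finite_toSet

theorem vertex_mem (v : K.vertices) : (v : E) ∈ L := by
  obtain ⟨g, hg, hvg⟩ := hK.exists_facet_superset v.2
  exact (isUnimodularSimplex_iff.1 (hK.unimodular g hg)).2.mem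
    ⟨v, hvg (Finset.mem_singleton_self _)⟩

theorem mem_integerLattice_of_homogeneousPoint_mem [Fintype K.vertices] {w : K.vertices → ℝ}
    (hw : Function.support w ∈ vertexSets K)
    (h : homogeneousPoint ((↑) : K.vertices → E) w ∈ L.prod intLattice) :
    w ∈ integerLattice K.vertices := by
  obtain rfl | w_ne_zero := eq_or_ne w 0
  · exact zero_mem _
  · obtain ⟨f, hf, hwf⟩ := hw (Function.support_nonempty_iff.2 w_ne_zero)
    obtain ⟨g, hg, hfg⟩ := hK.exists_facet_superset hf
    let j : g → K.vertices := fun v =>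
      ⟨v, K.down_closed hg.1 (Finset.singleton_subset_iff.2 v.2) (Finset.singleton_nonempty _)⟩
    have hj : Function.Injective j := fun v v' hv => Subtype.ext (Subtype.ext_iff.1 hv :)
    have comp_j : IsUnimodularFamily L (((↑) : K.vertices → E) ∘ j) :=
      (isUnimodularSimplex_iff.1 (hK.unimodular g hg)).2
    exact ((isUnimodularFamily_comp_iff hj).1 comp_j w
      fun v hv => ⟨⟨v, hfg (hwf hv)⟩, rfl⟩).1 h

/-- The cones over the simplices of a unimodular triangulation placed at height `1`. -/
noncomputable def coneOver : UnimodularFan.{v} (L.prod intLattice) where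
  Ray := K.vertices
  fintypeRay := hK.finite_vertices.fintype
  gen v := (v, 1)
  faces := vertexSets K
  empty_mem h := (Set.not_nonempty_empty h).elim
  isLowerSet _ _ hts hs ht := (hs (ht.mono hts)).imp fun _ hf => ⟨hf.1, hts.trans hf.2⟩
  gen_mem v := AddSubgroup.mem_prod.2
    ⟨hK.vertex_mem v, by simpa using natCast_mem_intLattice 1⟩
  injOn := by
    let := hK.finite_vertices.fintype
    exact injOn_homogeneousPoint_vertices
  integral w hw h := by
    let := hK.finite_vertices.fintype
    exact hK.mem_integerLattice_of_homogeneousPoint_mem hw.2 h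

theorem cone_coneOver (hP : P.Nonempty) :
    hK.coneOver.cone = {y | 0 ≤ y.2 ∧ y.1 ∈ y.2 • P} := by
  let := hK.finite_vertices.fintype
  rw [← hK.space_eq] at hP
  exact (image_homogeneousPoint_faceWeights hP).trans (by rw [hK.space_eq])

end IsUnimodularTriangulation

end ConeOver

namespace UnimodularFan

section Slice

variable {E : Type*} [AddCommGroup E] [Module ℝ E] {L : AddSubgroup E}
  {F : UnimodularFan.{u} (L.prod intLattice)}
  (hF : ∀ s ∈ F.faces, ∀ i ∈ s, (F.gen i).2 = 1)

include hF in
theorem point_eq_homogeneousPoint {w : F.Ray → ℝ} (hw : Function.support w ∈ F.faces) :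
    F.point w = homogeneousPoint (fun i => (F.gen i).1) w := by
  refine Finset.sum_congr rfl fun i _ => ?_
  obtain hi | hi := eq_or_ne (w i) 0
  · rw [hi, zero_smul, zero_smul]
  · rw [← hF _ hw i hi]

include hF in
theorem mem_convexHull_image_fst_gen_iff {s : Set F.Ray} (hs : s ∈ F.faces) {x : E} :
    x ∈ convexHull ℝ ((fun i => (F.gen i).1) '' s) ↔
      ∃ w : F.Ray → ℝ, 0 ≤ w ∧ Function.support w ⊆ s ∧ F.point w = (x, 1) := by
  rw [mem_convexHull_image_iff one_pos, one_smul]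
  refine exists_congr fun w => and_congr_right fun _ => and_congr_right fun hws => ?_
  rw [point_eq_homogeneousPoint hF (F.isLowerSet hws hs)]

include hF in
theorem affineIndependent_fst_gen {s : Set F.Ray} (hs : s ∈ F.faces) :
    AffineIndependent ℝ fun i : s => (F.gen i).1 := by
  refine (affineIndependent_iff_homogeneousPoint (p := fun i => (F.gen i).1)).2 fun w hws hw => ?_
  have support_mem : Function.support w ∈ F.faces := F.isLowerSet hws hs
  exact eq_zero_of_point_eq_zero support_mem ((point_eq_homogeneousPoint hF support_mem).trans hw)

/-- The slice at height `1` of a fan all of whose generators have height `1`, a simplicial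
complex. -/
def slice : Geometry.SimplicialComplex ℝ E :=
  .ofErase {f | ∃ s ∈ F.faces, (fun i => (F.gen i).1) '' s = f}
    (by
      rintro f ⟨s, hs, hsf⟩
      have range_eq : Set.range (fun i : s => (F.gen i).1) = f := by
        rw [← hsf, Set.image_eq_range]
      exact (affineIndependent_fst_gen hF hs).range.mono range_eq.ge)
    (by
      rintro f f' hf'f ⟨s, hs, hsf⟩
      refine ⟨s ∩ (fun i => (F.gen i).1) ⁻¹' f', F.isLowerSet Set.inter_subset_left hs, ?_⟩
      rw [Set.image_inter_preimage, hsf, Set.inter_eq_right]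
      exact hf'f)
    (by
      rintro f ⟨s, hs, hsf⟩ f' ⟨s', hs', hsf'⟩ x ⟨hx, hx'⟩
      rw [← hsf, mem_convexHull_image_fst_gen_iff hF hs] at hx
      rw [← hsf', mem_convexHull_image_fst_gen_iff hF hs'] at hx'
      obtain ⟨w, hw, hws, hwx⟩ := hx
      obtain ⟨w', hw', hws', hwx'⟩ := hx'
      obtain rfl : w = w' := F.injOn ⟨hw, F.isLowerSet hws hs⟩ ⟨hw', F.isLowerSet hws' hs'⟩
        (hwx.trans hwx'.symm)
      rw [← hsf, ← hsf']
      exact convexHull_mono (Set.image_inter_subset _ _ _)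
        ((mem_convexHull_image_fst_gen_iff hF (F.isLowerSet Set.inter_subset_left hs)).2
          ⟨w, hw, Set.subset_inter hws hws', hwx⟩))

theorem mem_faces_slice {f : Finset E} : f ∈ (slice hF).faces ↔
    f.Nonempty ∧ ∃ s ∈ F.faces, (fun i => (F.gen i).1) '' s = (f : Set E) := by
  rw [Finset.nonempty_iff_ne_empty, and_comm]
  rfl

theorem finite_faces_slice : (slice hF).faces.Finite := by
  refine Set.Finite.of_finite_image ((Set.toFinite F.faces).image
    (fun s => (fun i => (F.gen i).1) '' s) |>.subset ?_) Finset.coe_injective.injOn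
  rintro _ ⟨f, hf, rfl⟩
  exact ((mem_faces_slice hF).1 hf).2

theorem space_slice : (slice hF).space = {x | (x, (1 : ℝ)) ∈ F.cone} := by
  ext x
  rw [Geometry.SimplicialComplex.mem_space_iff]
  constructor
  · rintro ⟨f, hf, hx⟩
    obtain ⟨-, s, hs, hsf⟩ := (mem_faces_slice hF).1 hf
    rw [← hsf, mem_convexHull_image_fst_gen_iff hF hs] at hx
    obtain ⟨w, hw, hws, hwx⟩ := hx
    exact ⟨w, ⟨hw, F.isLowerSet hws hs⟩, hwx⟩
  · rintro ⟨w, ⟨hw, hwF⟩, hwx⟩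
    obtain ⟨f, hf⟩ := ((Function.support w).toFinite.image fun i => (F.gen i).1).exists_finset_coe
    have x_mem := (mem_convexHull_image_fst_gen_iff hF hwF).2 ⟨w, hw, subset_rfl, hwx⟩
    rw [← hf] at x_mem
    exact ⟨f, (mem_faces_slice hF).2
      ⟨Finset.coe_nonempty.1 (convexHull_nonempty_iff.1 ⟨x, x_mem⟩), _, hwF, hf.symm⟩, x_mem⟩

theorem isUnimodularSimplex_of_mem_faces_slice {f : Finset E} (hf : f ∈ (slice hF).faces) :
    IsUnimodularSimplex L f := by
  obtain ⟨f_nonempty, s, hs, hsf⟩ := (mem_faces_slice hF).1 hf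
  have exists_ray (v : f) : ∃ i ∈ s, (F.gen i).1 = v := hsf.ge v.2
  choose ray ray_mem gen_ray using exists_ray
  have ray_injective : Function.Injective ray := fun v v' h =>
    Subtype.ext (by rw [← gen_ray, ← gen_ray, h])
  have coe_eq : ((↑) : f → E) = (fun i => (F.gen i).1) ∘ ray := funext fun v => (gen_ray v).symm
  refine isUnimodularSimplex_iff.2 ⟨f_nonempty, ?_⟩
  rw [coe_eq, isUnimodularFamily_comp_iff ray_injective]
  intro w hw
  have support_mem : Function.support w ∈ F.faces :=
    F.isLowerSet (hw.trans (Set.range_subset_iff.2 ray_mem)) hs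
  rw [← point_eq_homogeneousPoint hF support_mem]
  exact ⟨mem_integerLattice_of_point_mem support_mem, fun h => linearCombination_mem h F.gen_mem⟩

theorem isUnimodularTriangulation_slice :
    IsUnimodularTriangulation L {x | (x, (1 : ℝ)) ∈ F.cone} (slice hF) where
  finite := finite_faces_slice hF
  space_eq := space_slice hF
  unimodular _ hf := isUnimodularSimplex_of_mem_faces_slice hF hf.1

end Slice

end UnimodularFan

section SemidirectFan

variable {J : Type*} {E : Type v} {E' : J → Type v} [AddCommGroup E] [Module ℝ E]
  [∀ j, AddCommGroup (E' j)] [∀ j, Module ℝ (E' j)] {L : AddSubgroup E}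
  {L' : ∀ j, AddSubgroup (E' j)} {Q : Set E} {P : ∀ j, Set (E' j)} {φ : E →ᵃ[ℝ] (J → ℝ)}

theorem homogenize_apply_mem_intLattice (hφ : ∀ x ∈ L, φ x ∈ integerLattice J) (j : J)
    {x : E × ℝ} (hx : x ∈ L.prod intLattice) : homogenize φ x j ∈ intLattice := by
  obtain ⟨hx1, hx2⟩ := AddSubgroup.mem_prod.1 hx
  exact mem_integerLattice.1
    ((homogenize_mem_iff (hφ 0 (zero_mem L)) hx2 x.1).2 (hφ _ hx1)) j

theorem homogenize_nonneg (hφ : ∀ a ∈ Q, ∀ j, 0 ≤ φ a j) {x : E × ℝ} (hr : 0 ≤ x.2)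
    (hx : x.1 ∈ x.2 • Q) (j : J) : 0 ≤ homogenize φ x j := by
  obtain ⟨a, ha, hax⟩ := hx
  have x_eq : x = x.2 • (a, (1 : ℝ)) := Prod.ext hax.symm (mul_one _).symm
  rw [x_eq, map_smul, homogenize_one]
  exact mul_nonneg hr (hφ a ha j)

variable (E E') in
/-- The linear map that forgets the heights of the points of the spaces `E' j`. -/
def dropHeights : (E × ℝ) × (∀ j, E' j × ℝ) →ₗ[ℝ] (E × ∀ j, E' j) × ℝ :=
  ((LinearMap.fst ℝ _ _ ∘ₗ LinearMap.fst ℝ _ _).prod (LinearMap.pi fun j =>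
    LinearMap.fst ℝ _ _ ∘ₗ LinearMap.proj j ∘ₗ LinearMap.snd ℝ _ _)).prod
    (LinearMap.snd ℝ _ _ ∘ₗ LinearMap.fst ℝ _ _)

theorem dropHeights_apply (y : (E × ℝ) × (∀ j, E' j × ℝ)) :
    dropHeights E E' y = ((y.1.1, fun j => (y.2 j).1), y.1.2) := rfl

variable (φ) in
/-- The points whose heights in the spaces `E' j` are given by `φ`. -/
def levelPoints (E' : J → Type v) : Set ((E × ℝ) × (∀ j, E' j × ℝ)) :=
  {y | ∀ j, (y.2 j).2 = homogenize φ y.1 j}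

theorem injOn_dropHeights : Set.InjOn (dropHeights E E') (levelPoints φ E') := by
  rintro ⟨x, y⟩ hy ⟨x', y'⟩ hy' h
  obtain ⟨h, hr⟩ := Prod.mk_inj.1 h
  obtain ⟨hx, hz⟩ := Prod.mk_inj.1 h
  obtain rfl : x = x' := Prod.ext hx hr
  exact Prod.ext rfl (funext fun j => Prod.ext (congrFun hz j) ((hy j).trans (hy' j).symm))

theorem dropHeights_mem {y : (E × ℝ) × (∀ j, E' j × ℝ)} (hy : y ∈ (L.prod intLattice).prod
      (AddSubgroup.pi Set.univ fun j => (L' j).prod intLattice)) :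
    dropHeights E E' y ∈ (L.prod (AddSubgroup.pi Set.univ L')).prod intLattice :=
  ⟨⟨hy.1.1, fun j hj => (hy.2 j hj).1⟩, hy.1.2⟩

theorem mem_of_dropHeights_mem (hφ : ∀ x ∈ L, φ x ∈ integerLattice J)
    {y : (E × ℝ) × (∀ j, E' j × ℝ)} (hy : y ∈ levelPoints φ E')
    (h : dropHeights E E' y ∈ (L.prod (AddSubgroup.pi Set.univ L')).prod intLattice) :
    y ∈ (L.prod intLattice).prod
      (AddSubgroup.pi Set.univ fun j => (L' j).prod intLattice) := by
  have fst_mem : y.1 ∈ L.prod intLattice := ⟨h.1.1, h.2⟩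
  refine ⟨fst_mem, fun j hj => ⟨h.1.2 j hj, ?_⟩⟩
  have snd_mem := homogenize_apply_mem_intLattice hφ j fst_mem
  rwa [← hy j] at snd_mem

theorem preimage_image_dropHeights (hφ : ∀ a ∈ Q, ∀ j, 0 ≤ φ a j) :
    {x | (x, (1 : ℝ)) ∈ dropHeights E E' '' {y | (0 ≤ y.1.2 ∧ y.1.1 ∈ y.1.2 • Q) ∧
      ∀ j, (0 ≤ (y.2 j).2 ∧ (y.2 j).1 ∈ (y.2 j).2 • P j) ∧
        (y.2 j).2 = homogenize φ y.1 j}} =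
      {x | x.1 ∈ Q ∧ ∀ j, x.2 j ∈ φ x.1 j • P j} := by
  ext ⟨x, z⟩
  constructor
  · rintro ⟨⟨⟨x', r⟩, y⟩, ⟨⟨-, hx⟩, hy⟩, h⟩
    obtain ⟨⟨rfl, rfl⟩, rfl⟩ : (x' = x ∧ (fun j => (y j).1) = z) ∧ r = 1 := by
      simpa only [dropHeights_apply, Prod.mk.injEq] using h
    refine ⟨by simpa using hx, fun j => ?_⟩
    have height_eq : (y j).2 = φ x' j := (hy j).2.trans (congrFun (homogenize_one φ x') j)
    exact height_eq ▸ (hy j).1.2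
  · rintro ⟨hx, hz⟩
    refine ⟨((x, 1), fun j => (z j, φ x j)), ⟨⟨zero_le_one, by simpa using hx⟩, fun j =>
      ⟨⟨hφ x hx j, hz j⟩, (congrFun (homogenize_one φ x) j).symm⟩⟩, rfl⟩

variable {S : Geometry.SimplicialComplex ℝ E} {T : ∀ j, Geometry.SimplicialComplex ℝ (E' j)}

theorem exists_unimodularFan_semidirectProduct [Finite J]
    (hφL : ∀ x ∈ L, φ x ∈ integerLattice J) (hφQ : ∀ a ∈ Q, ∀ j, 0 ≤ φ a j)
    (hS : IsUnimodularTriangulation L Q S) (hT : ∀ j, IsUnimodularTriangulation (L' j) (P j) (T j))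
    (hQ : Q.Nonempty) (hP : ∀ j, (P j).Nonempty) :
    ∃ F : UnimodularFan.{v} ((L.prod (AddSubgroup.pi Set.univ L')).prod intLattice),
      {x | (x, (1 : ℝ)) ∈ F.cone} = {x | x.1 ∈ Q ∧ ∀ j, x.2 j ∈ φ x.1 j • P j} ∧
      F.LiesOver ((LinearMap.fst ℝ E (∀ j, E' j)).prodMap LinearMap.id) hS.coneOver := by
  obtain ⟨F, cone_F, hF⟩ := UnimodularFan.exists_cone_eq_fibreProduct
    (T := fun j => (hT j).coneOver) (φ := fun j => LinearMap.proj j ∘ₗ homogenize φ)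
    (δ := fun j => LinearMap.snd ℝ (E' j) ℝ) hS.coneOver
    (fun j x hx => homogenize_apply_mem_intLattice hφL j hx)
    (fun j x hx => by
      rw [hS.cone_coneOver hQ] at hx
      exact homogenize_nonneg hφQ hx.1 hx.2 j)
    (fun j a => rfl)
  have cone_subset : F.cone ⊆ levelPoints φ E' := fun y hy => by
    rw [cone_F] at hy
    exact fun j => (hy.2 j).2
  have injOn : Set.InjOn (dropHeights E E') F.cone := injOn_dropHeights.mono cone_subset
  refine ⟨F.map (dropHeights E E') (fun _ => dropHeights_mem) injOn
    (fun y hy => mem_of_dropHeights_mem hφL (cone_subset hy)), ?_, hF⟩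
  rw [UnimodularFan.cone_map, cone_F]
  simp only [hS.cone_coneOver hQ, fun j => (hT j).cone_coneOver (hP j)]
  exact preimage_image_dropHeights hφQ

end SemidirectFan

section LiesOverConeOver

variable {E V : Type*} [AddCommGroup E] [Module ℝ E] [AddCommGroup V] [Module ℝ V]
  {L : AddSubgroup V} {Q : Set V} {S : Geometry.SimplicialComplex ℝ V}
  {hS : IsUnimodularTriangulation L Q S} {π : E →ₗ[ℝ] V}

theorem refines_pullbackCells (hS : IsUnimodularTriangulation L Q S)
    {K : Geometry.SimplicialComplex ℝ E} (h : ∀ f ∈ K.faces, ∃ g ∈ S.faces, π '' f ⊆ g) :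
    Refines K (pullbackCells π K.space S) := by
  intro f hf
  obtain ⟨g, hg, hfg⟩ := h f hf
  obtain ⟨G, hG, hgG⟩ := hS.exists_facet_superset hg
  refine ⟨_, ⟨G, hG, rfl⟩, Set.subset_inter (K.convexHull_subset_space hf) ?_⟩
  refine convexHull_min ?_ ((convex_convexHull ℝ _).linear_preimage _)
  exact Set.image_subset_iff.1 (hfg.trans ((Finset.coe_subset.2 hgG).trans
    (subset_convexHull ℝ _)))

variable {L' : AddSubgroup E} {F : UnimodularFan.{u} (L'.prod intLattice)}
  (hF : F.LiesOver (π.prodMap LinearMap.id) hS.coneOver)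

include hF

theorem snd_gen_eq_one_of_liesOver_coneOver : ∀ s ∈ F.faces, ∀ i ∈ s, (F.gen i).2 = 1 := by
  intro s hs i hi
  obtain ⟨t, -, hst⟩ := hF s hs
  obtain ⟨v, -, hv⟩ := hst ⟨i, hi, rfl⟩
  exact (congrArg Prod.snd hv).symm

theorem exists_image_subset_of_liesOver_coneOver {f : Finset E}
    (hf : f ∈ (UnimodularFan.slice (snd_gen_eq_one_of_liesOver_coneOver hF)).faces) :
    ∃ g ∈ S.faces, π '' f ⊆ g := by
  obtain ⟨f_nonempty, s, hs, hsf⟩ := (UnimodularFan.mem_faces_slice _).1 hf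
  rw [← Finset.coe_nonempty, ← hsf, Set.image_nonempty] at f_nonempty
  obtain ⟨t, ht, hst⟩ := hF s hs
  obtain ⟨g, hg, htg⟩ := ht (((f_nonempty.image _).mono hst).of_image)
  refine ⟨g, hg, ?_⟩
  rw [← hsf]
  rintro _ ⟨_, ⟨i, hi, rfl⟩, rfl⟩
  obtain ⟨v, hv, hvi⟩ := hst ⟨i, hi, rfl⟩
  have fst_mem : (hS.coneOver.gen v).1 ∈ g := htg hv
  rwa [hvi] at fst_mem

end LiesOverConeOver

section SemidirectProduct

variable {d n : ℕ} {e : Fin n → ℕ} {Q : Set (Fin d → ℝ)} {P : ∀ i : Fin n, Set (Fin (e i) → ℝ)}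
  {φ : (Fin d → ℝ) →ᵃ[ℝ] (Fin n → ℝ)}

theorem semidirectProduct_eq (hQ : Convex ℝ Q) (hP : ∀ i, Convex ℝ (P i))
    (hφ : ∀ a ∈ Q, ∀ i, 0 ≤ φ a i) :
    semidirectProduct Q φ P = {x | x.1 ∈ Q ∧ ∀ i, x.2 i ∈ φ x.1 i • P i} := by
  have iUnion_eq : (⋃ a ∈ Q, {a} ×ˢ Set.pi Set.univ fun i => φ a i • P i) =
      {x : (Fin d → ℝ) × (∀ i : Fin n, Fin (e i) → ℝ) |
        x.1 ∈ Q ∧ ∀ i, x.2 i ∈ φ x.1 i • P i} := by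
    ext ⟨x, y⟩
    simp
  rw [semidirectProduct, iUnion_eq]
  refine Convex.convexHull_eq ?_
  rintro ⟨x, y⟩ ⟨hx, hy⟩ ⟨x', y'⟩ ⟨hx', hy'⟩ a b ha hb hab
  refine ⟨hQ hx hx' ha hb hab, fun i => ?_⟩
  change a • y i + b • y' i ∈ φ (a • x + b • x') i • P i
  have apply_combo : φ (a • x + b • x') i = a * φ x i + b * φ x' i := by
    rw [Convex.combo_affine_apply hab]
    rfl
  rw [apply_combo, (hP i).add_smul (mul_nonneg ha (hφ x hx i)) (mul_nonneg hb (hφ x' hx' i)),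
    mul_smul, mul_smul]
  exact Set.add_mem_add (Set.smul_mem_smul_set (hy i)) (Set.smul_mem_smul_set (hy' i))

theorem isUnimodularTriangulation_bot {E : Type*} [AddCommGroup E] [Module ℝ E]
    (L : AddSubgroup E) : IsUnimodularTriangulation L ∅ ⊥ :=
  ⟨Set.finite_empty, Geometry.SimplicialComplex.space_bot, fun _ hs => hs.1.elim⟩

theorem exists_isUnimodularTriangulation_semidirectProduct
    (hQ : Convex ℝ Q) (hP : ∀ i, Convex ℝ (P i)) (hφ : IsAdmissibleMap Q φ)
    {S : Geometry.SimplicialComplex ℝ (Fin d → ℝ)}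
    {T : ∀ i, Geometry.SimplicialComplex ℝ (Fin (e i) → ℝ)}
    (hS : IsUnimodularTriangulation (integerLattice (Fin d)) Q S)
    (hT : ∀ i, IsUnimodularTriangulation (integerLattice (Fin (e i))) (P i) (T i)) :
    ∃ K, IsUnimodularTriangulation (productLattice d e) (semidirectProduct Q φ P) K ∧
      Refines K (pullbackCells (LinearMap.fst ℝ (Fin d → ℝ) (∀ i : Fin n, Fin (e i) → ℝ))
        (semidirectProduct Q φ P) S) := by
  obtain h_empty | ⟨x, hx⟩ := (semidirectProduct Q φ P).eq_empty_or_nonempty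
  · rw [h_empty]
    exact ⟨⊥, isUnimodularTriangulation_bot _, fun s hs => hs.elim⟩
  rw [semidirectProduct_eq hQ hP hφ.nonneg] at hx ⊢
  obtain ⟨F, slice_F, hF⟩ := exists_unimodularFan_semidirectProduct hφ.integral hφ.nonneg hS hT
    ⟨x.1, hx.1⟩ (fun i => Set.smul_set_nonempty.1 ⟨x.2 i, hx.2 i⟩)
  have isUnimodularTriangulation :=
    UnimodularFan.isUnimodularTriangulation_slice (snd_gen_eq_one_of_liesOver_coneOver hF)
  rw [slice_F] at isUnimodularTriangulation
  refine ⟨_, isUnimodularTriangulation, ?_⟩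
  rw [← isUnimodularTriangulation.space_eq]
  exact refines_pullbackCells hS fun f hf => exists_image_subset_of_liesOver_coneOver hF hf

end SemidirectProduct

section NestedPolytope

variable {κ : Type*} {L : AddSubgroup (κ → ℝ)} {Q : Set (κ → ℝ)}

theorem IsLatticePolytope.convex {E : Type*} [AddCommGroup E] [Module ℝ E] {L : AddSubgroup E}
    {P : Set E} (hP : IsLatticePolytope L P) : Convex ℝ P := by
  obtain ⟨V, -, rfl⟩ := hP
  exact convex_convexHull ℝ _

theorem IsLatticePolytope.finite_extremePoints (hQ : IsLatticePolytope L Q) :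
    (Set.extremePoints ℝ Q).Finite := by
  obtain ⟨V, -, rfl⟩ := hQ
  exact V.finite_toSet.subset extremePoints_convexHull_subset

theorem IsLatticePolytope.convexHull_extremePoints [Finite κ] (hQ : IsLatticePolytope L Q) :
    convexHull ℝ (Set.extremePoints ℝ Q) = Q := by
  have isCompact_Q : IsCompact Q := by
    obtain ⟨V, -, rfl⟩ := hQ
    exact V.finite_toSet.isCompact_convexHull ℝ
  rw [← (hQ.finite_extremePoints.isClosed_convexHull ℝ).closure_eq,
    closure_convexHull_extremePoints isCompact_Q hQ.convex]

theorem nestedPolytope_eq_semidirectProduct {n : ℕ} {e : Fin n → ℕ} {Q : Set (Fin n → ℝ)}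
    (hQ : convexHull ℝ (Set.extremePoints ℝ Q) = Q) (P : ∀ i : Fin n, Set (Fin (e i) → ℝ)) :
    nestedPolytope Q P = semidirectProduct Q (AffineMap.id ℝ _) P := by
  refine (convexHull_mono (Set.biUnion_subset_biUnion_left extremePoints_subset)).antisymm
    (convexHull_min ?_ (convex_convexHull ℝ _))
  rintro ⟨a, y⟩ hx
  obtain ⟨a, ha, rfl, hy⟩ : ∃ a' ∈ Q, a = a' ∧ ∀ i, y i ∈ a i • P i := by simpa using hx
  choose z hzP hz using hy
  let g : (Fin n → ℝ) →ₗ[ℝ] (Fin n → ℝ) × (∀ i, Fin (e i) → ℝ) :=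
    LinearMap.id.prod (LinearMap.pi fun i => (LinearMap.proj i).smulRight (z i))
  have image_a : g a = (a, y) := Prod.ext rfl (funext hz)
  rw [← hQ] at ha
  rw [← image_a]
  refine convexHull_min (t := g ⁻¹' _) (fun v hv => subset_convexHull ℝ _ ?_)
    ((convex_convexHull ℝ _).linear_preimage g) ha
  exact Set.mem_biUnion hv ⟨rfl, fun i _ => Set.smul_mem_smul_set (hzP i)⟩

end NestedPolytope

theorem mainTheorem10_general :
    (∀ (d n : ℕ) (e : Fin n → ℕ) (Q : Set (Fin d → ℝ)) (P : ∀ i : Fin n, Set (Fin (e i) → ℝ))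
        (φ : (Fin d → ℝ) →ᵃ[ℝ] (Fin n → ℝ)),
      Convex ℝ Q → (∀ i, Convex ℝ (P i)) → IsAdmissibleMap Q φ →
      ∀ (S : Geometry.SimplicialComplex ℝ (Fin d → ℝ))
        (T : ∀ i, Geometry.SimplicialComplex ℝ (Fin (e i) → ℝ)),
      IsUnimodularTriangulation (integerLattice (Fin d)) Q S →
      (∀ i, IsUnimodularTriangulation (integerLattice (Fin (e i))) (P i) (T i)) →
      ∃ K, IsUnimodularTriangulation (productLattice d e) (semidirectProduct Q φ P) K ∧
        Refines K (pullbackCells (LinearMap.fst ℝ (Fin d → ℝ) (∀ i, Fin (e i) → ℝ))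
          (semidirectProduct Q φ P) S)) ∧
    (∀ (n : ℕ) (e : Fin n → ℕ) (Q : Set (Fin n → ℝ)) (P : ∀ i : Fin n, Set (Fin (e i) → ℝ)),
      IsLatticePolytope (integerLattice (Fin n)) Q → (∀ a ∈ Q, 0 ≤ a) →
      (∀ i, Convex ℝ (P i)) →
      ∀ (S : Geometry.SimplicialComplex ℝ (Fin n → ℝ))
        (T : ∀ i, Geometry.SimplicialComplex ℝ (Fin (e i) → ℝ)),
      IsUnimodularTriangulation (integerLattice (Fin n)) Q S →
      (∀ i, IsUnimodularTriangulation (integerLattice (Fin (e i))) (P i) (T i)) →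
      ∃ K, IsUnimodularTriangulation (productLattice n e) (nestedPolytope Q P) K ∧
        Refines K (pullbackCells (LinearMap.fst ℝ (Fin n → ℝ) (∀ i, Fin (e i) → ℝ))
          (nestedPolytope Q P) S)) := by
  refine ⟨fun d n e Q P φ hQ hP hφ S T hS hT =>
    exists_isUnimodularTriangulation_semidirectProduct hQ hP hφ hS hT, ?_⟩
  intro n e Q P hQ hQ0 hP S T hS hT
  rw [nestedPolytope_eq_semidirectProduct hQ.convexHull_extremePoints]
  exact exists_isUnimodularTriangulation_semidirectProduct hQ.convex hP
    ⟨fun x hx => hx, fun a ha i => hQ0 a ha i⟩ hS hT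

theorem mainTheorem10 :
    -- one factor, with refinement of the pull-back
    (∀ (d e : ℕ) (Q : Set (Fin d → ℝ)) (P : Set (Fin e → ℝ))
        (φ : (Fin d → ℝ) →ᵃ[ℝ] (Fin 1 → ℝ)),
      IsLatticePolytope (integerLattice (Fin d)) Q →
      IsLatticePolytope (integerLattice (Fin e)) P →
      IsAdmissibleMap Q φ →
      ∀ (S : Geometry.SimplicialComplex ℝ (Fin d → ℝ))
        (T : Geometry.SimplicialComplex ℝ (Fin e → ℝ)),
      IsUnimodularTriangulation (integerLattice (Fin d)) Q S →
      IsUnimodularTriangulation (integerLattice (Fin e)) P T →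
      ∃ K : Geometry.SimplicialComplex ℝ ((Fin d → ℝ) × (Fin 1 → Fin e → ℝ)),
        IsUnimodularTriangulation (productLattice d fun _ : Fin 1 => e)
          (semidirectProduct (e := fun _ : Fin 1 => e) Q φ fun _ => P) K ∧
        Refines K
          (pullbackCells (LinearMap.fst ℝ (Fin d → ℝ) (Fin 1 → Fin e → ℝ))
            (semidirectProduct (e := fun _ : Fin 1 => e) Q φ fun _ => P) S)) ∧
    -- several factors
    (∀ (d n : ℕ) (e : Fin n → ℕ) (Q : Set (Fin d → ℝ)) (P : ∀ i : Fin n, Set (Fin (e i) → ℝ))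
        (φ : (Fin d → ℝ) →ᵃ[ℝ] (Fin n → ℝ)),
      IsLatticePolytope (integerLattice (Fin d)) Q →
      (∀ i, IsLatticePolytope (integerLattice (Fin (e i))) (P i)) →
      IsAdmissibleMap Q φ →
      (∃ S, IsUnimodularTriangulation (integerLattice (Fin d)) Q S) →
      (∀ i, ∃ T, IsUnimodularTriangulation (integerLattice (Fin (e i))) (P i) T) →
      ∃ K, IsUnimodularTriangulation (productLattice d e) (semidirectProduct Q φ P) K) ∧
    -- nested configurations
    (∀ (d k : ℕ) (e : Fin (d + 1) → ℕ) (Q : Set (Fin (d + 1) → ℝ))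
        (P : ∀ i : Fin (d + 1), Set (Fin (e i) → ℝ)),
      IsLatticePolytope (integerLattice (Fin (d + 1))) Q →
      Q ⊆ (k : ℝ) • stdSimplex ℝ (Fin (d + 1)) →
      (∀ i, IsLatticePolytope (integerLattice (Fin (e i))) (P i)) →
      (∃ S, IsUnimodularTriangulation (integerLattice (Fin (d + 1))) Q S) →
      (∀ i, ∃ T, IsUnimodularTriangulation (integerLattice (Fin (e i))) (P i) T) →
      ∃ K, IsUnimodularTriangulation (productLattice (d + 1) e) (nestedPolytope Q P) K) := by
  obtain ⟨semidirect, nested⟩ := mainTheorem10_general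
  refine ⟨?_, ?_, ?_⟩
  · intro d e Q P φ hQ hP hφ S T hS hT
    exact semidirect d 1 (fun _ => e) Q _ φ hQ.convex (fun _ => hP.convex) hφ S _ hS fun _ => hT
  · rintro d n e Q P φ hQ hP hφ ⟨S, hS⟩ hT
    choose T hT using hT
    exact (semidirect d n e Q P φ hQ.convex (fun i => (hP i).convex) hφ S T hS hT).imp
      fun _ => And.left
  · rintro d k e Q P hQ hQk hP ⟨S, hS⟩ hT
    choose T hT using hT
    have nonneg : ∀ a ∈ Q, 0 ≤ a := fun a ha => by
      obtain ⟨x, hx, rfl⟩ := hQk ha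
      exact smul_nonneg k.cast_nonneg hx.1
    exact (nested _ e Q P hQ nonneg (fun i => (hP i).convex) S T hS hT).imp fun _ => And.left
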